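/- Let $0\le t'<T$, let $W$ be a standard Brownian motion on a probability space with measure $\mathbb{Q}$, and let $V:[t',T]\to\mathbb{R}$ be a deterministic function such that $e^{2V}$ is integrable on $[t',T]$. Put $$\gamma^2(u)=\int_{t'}^u e^{2V(\ell)}\,d\ell ,\qquad \gamma(u)=\sqrt{\gamma^2(u)},\qquad u\in[t',T].$$ Let $r,\beta\in\mathbb{R}$, $H_1>0$, and define the barrier $$\hat H(u)=H_1\exp\Bigl\{-r(T-u)+\tfrac{1+2\beta}{2}\bigl(\gamma^2(T)-\gamma^2(u)\bigr)\Bigr\},\qquad u\in[t',T].$$ Let $x>\hat H(t')$ and let $S$ be the geometric Brownian motion with drift $r$, deterministic volatility $e^{V(u)}$ and $S_{t'}=x$, that is, $$S_u=x\exp\Bigl\{r(u-t')-\tfrac12\gamma^2(u)+\int_{t'}^u e^{V(\ell)}\,dW_\ell\Bigr\},\qquad u\in[t',T],$$ where the stochastic integral process is taken with (almost surely) continuous paths. Let $\tau=\inf\{u\in[t',T]: S_u\le\hat H(u)\}$, with $\inf\emptyset=+\infty$. Then for every $u\in(t',T]$ and every Borel set $B\subseteq\mathbb{R}$, $$\mathbb{Q}\bigl[S_u\in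 B,\ \tau>u\bigr]=\int_B p_u(w)\,dw,$$ with the nonnegative density $$p_u(w)=\frac{\mathbf 1_{\{w>\hat H(u)\}}}{\gamma(u)\,w}\left[n\!\left(\frac{\log w-\mu_1}{\gamma(u)}\right)-\Bigl(\frac{\hat H(t')}{x}\Bigr)^{2\beta} n\!\left(\frac{\log w-\mu_2}{\gamma(u)}\right)\right],$$ where $n$ is the standard normal probability density function, $\mu_i=\log x_i+r(u-t')-\tfrac12\gamma^2(u)$ for $i=1,2$, $x_1=x$ and $x_2=\hat H(t')^2/x$. -/

import Mathlib

open MeasureTheory ProbabilityTheory Filter Topology Set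
open scoped NNReal ENNReal

noncomputable section

namespace BarrierGBM

/-- A real step function `∑ i, coef i • 1_{(left i, right i]}` with all intervals inside
`(s, t]` (the intervals need not be disjoint). -/
structure StepFun (s t : ℝ) where
  n : ℕ
  left : Fin n → ℝ
  right : Fin n → ℝ
  coef : Fin n → ℝ
  le_left : ∀ i, s ≤ left i
  left_le_right : ∀ i, left i ≤ right i
  right_le : ∀ i, right i ≤ t

/-- The underlying function of a step function. -/
def StepFun.eval {s t : ℝ} (φ : StepFun s t) (l : ℝ) : ℝ :=
  ∑ i, (Ioc (φ.left i) (φ.right i)).indicator (fun _ => φ.coef i) l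

/-- The elementary stochastic integral `∑ i, coef i * (W_{right i} - W_{left i})` of a step
function against a process indexed by `[0, ∞)` (it is used for `0 ≤ s` only). -/
def StepFun.wienerIntegral {Ω : Type*} {s t : ℝ} (φ : StepFun s t) (W : ℝ≥0 → Ω → ℝ) (ω : Ω) : ℝ :=
  ∑ i, φ.coef i * (W (φ.right i).toNNReal ω - W (φ.left i).toNNReal ω)

/-- `X` is (a version of) the stochastic integral `∫_s^t f(l) dW_l` of the deterministic function
`f ∈ L²(s, t)`: there are step functions converging to `f` in `L²(s, t)` whose elementary
integrals converge to `X` in `L²(Q)`. -/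
structure IsWienerIntegral {Ω : Type*} [MeasurableSpace Ω] (Q : Measure Ω) (W : ℝ≥0 → Ω → ℝ)
    (f : ℝ → ℝ) (s t : ℝ) (X : Ω → ℝ) : Prop where
  memLp_integrand : MemLp f 2 (volume.restrict (Ioc s t))
  memLp : MemLp X 2 Q
  exists_approx : ∃ φ : ℕ → StepFun s t,
    Tendsto (fun k => eLpNorm (fun l => (φ k).eval l - f l) 2 (volume.restrict (Ioc s t)))
      atTop (𝓝 0) ∧
    Tendsto (fun k => eLpNorm (fun ω => (φ k).wienerIntegral W ω - X ω) 2 Q) atTop (𝓝 0)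

/-- `M` is (the continuous version of) the stochastic integral process
`u ↦ ∫_{t₀}^u f(l) dW_l`, `u ∈ [t₀, T]`. -/
structure IsWienerIntegralProcess {Ω : Type*} [MeasurableSpace Ω] (Q : Measure Ω)
    (W : ℝ≥0 → Ω → ℝ) (f : ℝ → ℝ) (t₀ T : ℝ) (M : ℝ → Ω → ℝ) : Prop where
  isWienerIntegral : ∀ u ∈ Icc t₀ T, IsWienerIntegral Q W f t₀ u (M u)
  continuousOn : ∀ᵐ ω ∂Q, ContinuousOn (fun u => M u ω) (Icc t₀ T)

/-- The accumulated variance `γ²(u) = ∫_{t₀}^u e^{2 V(l)} dl`. -/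
def gammaSq (V : ℝ → ℝ) (t₀ u : ℝ) : ℝ :=
  ∫ l in t₀..u, Real.exp (2 * V l)

/-- The geometric Brownian motion with initial value `x` at time `t₀`, drift `r` and volatility
`e^V`, written through the process `M_u = ∫_{t₀}^u e^{V(l)} dW_l`. -/
def gbm {Ω : Type*} (x r : ℝ) (V : ℝ → ℝ) (t₀ : ℝ) (M : ℝ → Ω → ℝ) (u : ℝ) (ω : Ω) : ℝ :=
  x * Real.exp (r * (u - t₀) - gammaSq V t₀ u / 2 + M u ω)

/-- The barrier
`Ĥ(u) = H₁ exp(-r (T - u) + (1 + 2β)/2 * (γ²(T) - γ²(u)))`. -/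
def barrier (H₁ r β : ℝ) (V : ℝ → ℝ) (t₀ T u : ℝ) : ℝ :=
  H₁ * Real.exp (-r * (T - u) + (1 + 2 * β) / 2 * (gammaSq V t₀ T - gammaSq V t₀ u))

/-- `τ = inf {u ∈ [t₀, T] : S_u ≤ H(u)}`, with `inf ∅ = +∞`. -/
def hitTime {Ω : Type*} (S : ℝ → Ω → ℝ) (H : ℝ → ℝ) (t₀ T : ℝ) (ω : Ω) : EReal :=
  sInf ((fun u : ℝ => (u : EReal)) '' {u : ℝ | u ∈ Icc t₀ T ∧ S u ω ≤ H u})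

/-- `log y + r (u - t₀) - γ²(u) / 2`. -/
def logMean (r : ℝ) (V : ℝ → ℝ) (t₀ u y : ℝ) : ℝ :=
  Real.log y + r * (u - t₀) - gammaSq V t₀ u / 2

/-- The density
`1_{w > Ĥ(u)} / (γ(u) w) * [n((log w - μ₁) / γ(u)) - (Ĥ(t₀) / x)^(2β) n((log w - μ₂) / γ(u))]`
where `n` is the standard normal density, `μᵢ = log xᵢ + r (u - t₀) - γ²(u) / 2`, `x₁ = x` and
`x₂ = Ĥ(t₀)² / x`. -/
def jointDensity (x r H₁ β : ℝ) (V : ℝ → ℝ) (t₀ T u w : ℝ) : ℝ :=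
  let γ : ℝ := √(gammaSq V t₀ u)
  let H : ℝ → ℝ := barrier H₁ r β V t₀ T
  let μ₁ : ℝ := logMean r V t₀ u x
  let μ₂ : ℝ := logMean r V t₀ u (H t₀ ^ 2 / x)
  (Ioi (H u)).indicator (fun w : ℝ =>
    1 / (γ * w) *
      (gaussianPDFReal 0 1 ((Real.log w - μ₁) / γ)
        - (H t₀ / x) ^ (2 * β) * gaussianPDFReal 0 1 ((Real.log w - μ₂) / γ))) w

end BarrierGBM

end

/-!
Write `X_s = M_s + β γ²(s)`. The drift of the logarithm of the barrier is chosen so that, up to one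
and the same deterministic shift, `log S_s` is `X_s` and `log Ĥ(s)` is the constant
`b = log (Ĥ(t₀) / x) < 0` (`gbm_eq_exp`, `barrier_eq_exp`). Hence the first passage of `S` below the
barrier is the passage of `X`, a Brownian motion with drift `β` in the clock `γ²`, to the
level `b`.

The law of `X` comes from the `L²` approximation of `M` by elementary integrals: these form a
Gaussian process, their covariances are integrals of products of step functions, and both facts
pass to the limit (`isGaussianProcess_of_tendsto_eLpNorm`,
`IsWienerIntegralProcess.covariance_eq`). So `X_u - X_s` is independent of the past up to `s` with
law `N(βv, v)`, where `v = γ²(u) - γ²(s)` (`IsWienerIntegralProcess.isDriftedBrownian`).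

Neither the strong Markov property nor Girsanov's theorem is needed for the joint law of `X_u` and
the passage event. The law `N(βv, v)` weighted by `e^{-βz}` is symmetric, so on a finite time grid,
with `σ` the first grid time below the level,
`E[e^{-βX_u} g(X_u); σ ≤ u] = E[e^{-βX_u} g(2X_σ - X_u); σ ≤ u]`
(`IsDriftedBrownian.integral_passageValue`). As the mesh tends to zero the overshoot vanishes by
continuity of the paths and `X_σ → b`, while `e^{-βX_u}` dominates everything. Thus on the event
that `b` is reached, the law of `X_u` weighted by `e^{-βX_u}` is invariant under reflection in `b`
(`IsDriftedBrownian.setLIntegral_hitEvent`). A set above `b` is reflected to a set below `b`, where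
the level has certainly been reached, so the law of `X_u` on the passage event is explicit above
`b`; subtracting it from the free Gaussian law gives `IsDriftedBrownian.measure_survival`, and the
substitution `w = e^{k + y}` turns this into the stated density (`setLIntegral_jointDensity`).
-/

namespace BarrierGBM

/-! ### Limits in `L²` of random variables and of Gaussian processes -/

theorem tendsto_integral_mul_of_tendsto_eLpNorm {α : Type*} [MeasurableSpace α] {μ : Measure α}
    {f g : ℕ → α → ℝ} {F G : α → ℝ} (hf : ∀ k, MemLp (f k) 2 μ) (hg : ∀ k, MemLp (g k) 2 μ)
    (hF : MemLp F 2 μ) (hG : MemLp G 2 μ)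
    (hfF : Tendsto (fun k => eLpNorm (f k - F) 2 μ) atTop (𝓝 0))
    (hgG : Tendsto (fun k => eLpNorm (g k - G) 2 μ) atTop (𝓝 0)) :
    Tendsto (fun k => ∫ a, f k a * g k a ∂μ) atTop (𝓝 (∫ a, F a * G a ∂μ)) := by
  have h1 := (Lp.tendsto_Lp_iff_tendsto_eLpNorm'' f hf F hF).2 hfF
  have h2 := (Lp.tendsto_Lp_iff_tendsto_eLpNorm'' g hg G hG).2 hgG
  have h : ∀ {u v : α → ℝ} (hu : MemLp u 2 μ) (hv : MemLp v 2 μ),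
      inner ℝ (hu.toLp u) (hv.toLp v) = ∫ a, u a * v a ∂μ := by
    intro u v hu hv
    rw [L2.inner_def]
    refine integral_congr_ae ?_
    filter_upwards [hu.coeFn_toLp, hv.coeFn_toLp] with a ha hb
    simp [ha, hb, mul_comm]
  simpa only [h] using h1.inner (𝕜 := ℝ) h2

theorem tendsto_integral_of_tendsto_eLpNorm_two {Ω : Type*} [MeasurableSpace Ω] {Q : Measure Ω}
    [IsProbabilityMeasure Q] {f : ℕ → Ω → ℝ} {F : Ω → ℝ} (hf : ∀ k, MemLp (f k) 2 Q)
    (hF : MemLp F 2 Q) (hfF : Tendsto (fun k => eLpNorm (f k - F) 2 Q) atTop (𝓝 0)) :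
    Tendsto (fun k => ∫ ω, f k ω ∂Q) atTop (𝓝 (∫ ω, F ω ∂Q)) := by
  have h1 : MemLp (fun _ : Ω => (1 : ℝ)) 2 Q := memLp_const 1
  simpa using tendsto_integral_mul_of_tendsto_eLpNorm hf (fun _ => h1) hF h1 hfF (by simp)

theorem tendsto_covariance_of_tendsto_eLpNorm {Ω : Type*} [MeasurableSpace Ω] {Q : Measure Ω}
    [IsProbabilityMeasure Q] {f g : ℕ → Ω → ℝ} {F G : Ω → ℝ} (hf : ∀ k, MemLp (f k) 2 Q)
    (hg : ∀ k, MemLp (g k) 2 Q) (hF : MemLp F 2 Q) (hG : MemLp G 2 Q)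
    (hfF : Tendsto (fun k => eLpNorm (f k - F) 2 Q) atTop (𝓝 0))
    (hgG : Tendsto (fun k => eLpNorm (g k - G) 2 Q) atTop (𝓝 0)) :
    Tendsto (fun k => cov[f k, g k; Q]) atTop (𝓝 cov[F, G; Q]) := by
  rw [covariance_eq_sub hF hG]
  simp_rw [fun k => covariance_eq_sub (hf k) (hg k)]
  exact (tendsto_integral_mul_of_tendsto_eLpNorm hf hg hF hG hfF hgG).sub
    ((tendsto_integral_of_tendsto_eLpNorm_two hf hF hfF).mul
      (tendsto_integral_of_tendsto_eLpNorm_two hg hG hgG))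

/-- An `L²` limit of Gaussian random variables is Gaussian: means and variances converge, hence
so do the characteristic functions. -/
theorem hasGaussianLaw_of_tendsto_eLpNorm {Ω : Type*} [MeasurableSpace Ω] {Q : Measure Ω}
    [IsProbabilityMeasure Q] {f : ℕ → Ω → ℝ} {F : Ω → ℝ} (hf : ∀ k, HasGaussianLaw (f k) Q)
    (hF : MemLp F 2 Q) (hfF : Tendsto (fun k => eLpNorm (f k - F) 2 Q) atTop (𝓝 0)) :
    HasGaussianLaw F Q := by
  have hf2 k := (hf k).memLp_two
  have hmean := tendsto_integral_of_tendsto_eLpNorm_two hf2 hF hfF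
  have hvar := tendsto_covariance_of_tendsto_eLpNorm hf2 hf2 hF hF hfF hfF
  have hFm : AEMeasurable F Q := hF.aestronglyMeasurable.aemeasurable
  rw [covariance_self hFm] at hvar
  simp_rw [fun k => covariance_self (hf k).aemeasurable] at hvar
  have hdist : TendstoInDistribution f atTop F (fun _ => Q) Q :=
    (tendstoInMeasure_of_tendsto_eLpNorm two_ne_zero
      (fun k => (hf2 k).aestronglyMeasurable) hF.aestronglyMeasurable hfF).tendstoInDistribution
      (fun k => (hf k).aemeasurable)
  have hchar := ProbabilityMeasure.tendsto_iff_tendsto_charFun.1 hdist.tendsto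
  have hlaw : Q.map F = gaussianReal Q[F] Var[F; Q].toNNReal := by
    have : IsProbabilityMeasure (Q.map F) := Measure.isProbabilityMeasure_map hFm
    refine Measure.ext_of_charFun (funext fun t => tendsto_nhds_unique (hchar t) ?_)
    simp only [ProbabilityMeasure.coe_mk, (hf _).map_eq_gaussianReal, charFun_gaussianReal,
      Real.coe_toNNReal _ (variance_nonneg _ _)]
    refine (Complex.continuous_exp.tendsto _).comp (Tendsto.sub ?_ ?_)
    · exact (((Complex.continuous_ofReal.tendsto _).comp hmean).const_mul _).mul_const _
    · exact (((Complex.continuous_ofReal.tendsto _).comp hvar).mul_const _).div_const _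
  exact ⟨by rw [hlaw]; infer_instance⟩

theorem isGaussianProcess_of_tendsto_eLpNorm {Ω ι : Type*} [MeasurableSpace Ω] {Q : Measure Ω}
    [IsProbabilityMeasure Q] {f : ℕ → ι → Ω → ℝ} {F : ι → Ω → ℝ}
    (hf : ∀ k, IsGaussianProcess (f k) Q) (hF : ∀ i, MemLp (F i) 2 Q)
    (hfF : ∀ i, Tendsto (fun k => eLpNorm (f k i - F i) 2 Q) atTop (𝓝 0)) :
    IsGaussianProcess F Q where
  hasGaussianLaw I := by
    classical
    have hm : AEMeasurable (fun ω => I.restrict (F · ω)) Q :=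
      aemeasurable_pi_lambda _ fun i => (hF i).aestronglyMeasurable.aemeasurable
    refine ⟨isGaussian_of_isGaussian_map fun L => ?_⟩
    rw [AEMeasurable.map_map_of_aemeasurable (by fun_prop) hm]
    have hL : ∀ G : ι → Ω → ℝ, (L ∘ fun ω => I.restrict (G · ω))
        = ∑ i : I, L (Pi.single i 1) • G i := by
      intro G
      ext ω
      have hs : ∀ (i : I) (c : ℝ), (Pi.single i c : I → ℝ) = c • Pi.single i 1 := fun i c => by
        rw [← Pi.single_smul, smul_eq_mul, mul_one]
      change L (I.restrict (G · ω)) = _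
      rw [← Finset.univ_sum_single (I.restrict (G · ω)), map_sum, Finset.sum_apply]
      refine Finset.sum_congr rfl fun i _ => ?_
      rw [hs, map_smul, Pi.smul_apply, smul_eq_mul, smul_eq_mul, mul_comm]
      rfl
    refine (hasGaussianLaw_of_tendsto_eLpNorm (f := fun k => L ∘ fun ω => I.restrict (f k · ω))
      (fun k => ((hf k).hasGaussianLaw I).map L) ?_ ?_).isGaussian_map
    · rw [hL]
      exact memLp_finsetSum' _ fun i _ => (hF i).const_smul _
    · have hfm k i : AEStronglyMeasurable (f k i) Q :=
        ((hf k).aemeasurable i).aestronglyMeasurable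
      have hbound : ∀ k, eLpNorm ((L ∘ fun ω => I.restrict (f k · ω))
          - (L ∘ fun ω => I.restrict (F · ω))) 2 Q
          ≤ ∑ i : I, ‖L (Pi.single i 1)‖ₑ * eLpNorm (f k i - F i) 2 Q := by
        intro k
        rw [hL, hL, ← Finset.sum_sub_distrib]
        refine (eLpNorm_sum_le (fun i _ => ?_) one_le_two).trans
          (Finset.sum_le_sum fun i _ => ?_)
        · exact ((hfm k i).const_smul _).sub ((hF i).aestronglyMeasurable.const_smul _)
        · rw [← smul_sub, eLpNorm_const_smul]
      refine tendsto_of_tendsto_of_tendsto_of_le_of_le tendsto_const_nhds ?_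
        (fun _ => zero_le) hbound
      have : Tendsto (fun k => ∑ i : I, ‖L (Pi.single i 1)‖ₑ * eLpNorm (f k i - F i) 2 Q) atTop
          (𝓝 (∑ i : I, ‖L (Pi.single i 1)‖ₑ * 0)) :=
        tendsto_finsetSum _ fun i _ => ENNReal.Tendsto.const_mul (hfF i) (Or.inr enorm_ne_top)
      simpa using this

/-! ### The elementary stochastic integral -/

theorem StepFun.memLp_eval {s t : ℝ} (φ : StepFun s t) : MemLp φ.eval 2 volume := by
  have : φ.eval = fun l => ∑ i, (Ioc (φ.left i) (φ.right i)).indicator (fun _ => φ.coef i) l :=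
    rfl
  rw [this]
  refine memLp_finsetSum _ fun i _ => ?_
  exact memLp_indicator_const 2 measurableSet_Ioc _ (Or.inr measure_Ioc_lt_top.ne)

theorem StepFun.eval_of_notMem {s t : ℝ} (φ : StepFun s t) {l : ℝ} (hl : l ∉ Ioc s t) :
    φ.eval l = 0 := by
  refine Finset.sum_eq_zero fun i _ => indicator_of_notMem (fun h => hl ?_) _
  exact ⟨(φ.le_left i).trans_lt h.1, h.2.trans (φ.right_le i)⟩

theorem StepFun.integral_eval_mul_eval {s t s' t' : ℝ} (φ : StepFun s t) (ψ : StepFun s' t') :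
    ∫ l, φ.eval l * ψ.eval l = ∑ i, ∑ j, φ.coef i * ψ.coef j *
      volume.real (Ioc (φ.left i) (φ.right i) ∩ Ioc (ψ.left j) (ψ.right j)) := by
  have h : ∀ l, φ.eval l * ψ.eval l = ∑ i, ∑ j,
      (Ioc (φ.left i) (φ.right i) ∩ Ioc (ψ.left j) (ψ.right j)).indicator
        (fun _ => φ.coef i * ψ.coef j) l := by
    intro l
    simp only [StepFun.eval, Finset.sum_mul_sum]
    refine Finset.sum_congr rfl fun i _ => Finset.sum_congr rfl fun j _ => ?_
    exact (inter_indicator_mul (fun _ => φ.coef i) (fun _ => ψ.coef j) l).symm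
  have hm : ∀ i j, MeasurableSet (Ioc (φ.left i) (φ.right i) ∩ Ioc (ψ.left j) (ψ.right j)) :=
    fun i j => measurableSet_Ioc.inter measurableSet_Ioc
  have hint : ∀ i j, Integrable (fun l =>
      (Ioc (φ.left i) (φ.right i) ∩ Ioc (ψ.left j) (ψ.right j)).indicator
        (fun _ => φ.coef i * ψ.coef j) l) := fun i j =>
    (integrable_indicator_iff (hm i j)).2 (integrableOn_const
      (measure_inter_lt_top_of_left_ne_top measure_Ioc_lt_top.ne).ne)
  simp_rw [h]
  rw [integral_finsetSum _ fun i _ => integrable_finsetSum _ fun j _ => hint i j]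
  refine Finset.sum_congr rfl fun i _ => ?_
  rw [integral_finsetSum _ fun j _ => hint i j]
  refine Finset.sum_congr rfl fun j _ => ?_
  rw [integral_indicator (hm i j), setIntegral_const, smul_eq_mul, mul_comm]

theorem covariance_increments {Ω : Type*} [MeasurableSpace Ω] {Q : Measure Ω} {W : ℝ≥0 → Ω → ℝ}
    (hW : IsPreBrownianReal W Q) {a b c d : ℝ} (ha : 0 ≤ a) (hab : a ≤ b) (hc : 0 ≤ c)
    (hcd : c ≤ d) :
    cov[fun ω => W b.toNNReal ω - W a.toNNReal ω, fun ω => W d.toNNReal ω - W c.toNNReal ω; Q]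
      = volume.real (Ioc a b ∩ Ioc c d) := by
  have := hW.isGaussianProcess.isProbabilityMeasure
  have hm t := (hW.isGaussianProcess.hasGaussianLaw_eval t).memLp_two
  rw [covariance_fun_sub_fun_sub (hm _) (hm _) (hm _) (hm _)]
  simp only [hW.covariance_fun_eval, NNReal.coe_min, Real.coe_toNNReal _ ha,
    Real.coe_toNNReal _ hc, Real.coe_toNNReal _ (ha.trans hab), Real.coe_toNNReal _ (hc.trans hcd),
    Ioc_inter_Ioc, Real.volume_real_Ioc]
  grind

theorem StepFun.memLp_wienerIntegral {Ω : Type*} [MeasurableSpace Ω] {Q : Measure Ω}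
    {W : ℝ≥0 → Ω → ℝ} (hW : IsPreBrownianReal W Q) {s t : ℝ} (φ : StepFun s t) :
    MemLp (φ.wienerIntegral W) 2 Q := by
  have : φ.wienerIntegral W = fun ω =>
    ∑ i, φ.coef i * (W (φ.right i).toNNReal ω - W (φ.left i).toNNReal ω) := rfl
  rw [this]
  exact memLp_finsetSum _ fun i _ =>
    (hW.isGaussianProcess.hasGaussianLaw_sub.memLp_two).const_mul _

/-- The isometry of the elementary stochastic integral, in its polarized form. -/
theorem StepFun.covariance_wienerIntegral {Ω : Type*} [MeasurableSpace Ω] {Q : Measure Ω}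
    {W : ℝ≥0 → Ω → ℝ} (hW : IsPreBrownianReal W Q) {s t s' t' : ℝ} (hs : 0 ≤ s) (hs' : 0 ≤ s')
    (φ : StepFun s t) (ψ : StepFun s' t') :
    cov[φ.wienerIntegral W, ψ.wienerIntegral W; Q] = ∫ l, φ.eval l * ψ.eval l := by
  have := hW.isGaussianProcess.isProbabilityMeasure
  rw [StepFun.integral_eval_mul_eval]
  have hL : ∀ {s t : ℝ} (φ : StepFun s t) (i : Fin φ.n), MemLp (fun ω =>
      φ.coef i * (W (φ.right i).toNNReal ω - W (φ.left i).toNNReal ω)) 2 Q := fun φ i =>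
    (hW.isGaussianProcess.hasGaussianLaw_sub.memLp_two).const_mul _
  refine (covariance_fun_sum_fun_sum (hL φ) (hL ψ)).trans ?_
  refine Finset.sum_congr rfl fun i _ => Finset.sum_congr rfl fun j _ => ?_
  rw [covariance_const_mul_left, covariance_const_mul_right,
    covariance_increments hW (hs.trans (φ.le_left i)) (φ.left_le_right i)
      (hs'.trans (ψ.le_left j)) (ψ.left_le_right j), mul_assoc]

theorem StepFun.integral_wienerIntegral {Ω : Type*} [MeasurableSpace Ω] {Q : Measure Ω}
    {W : ℝ≥0 → Ω → ℝ} (hW : IsPreBrownianReal W Q) {s t : ℝ} (φ : StepFun s t) :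
    ∫ ω, φ.wienerIntegral W ω ∂Q = 0 := by
  have hI t := hW.integrable_eval t
  simp only [StepFun.wienerIntegral]
  have hterm : ∀ i, Integrable (fun ω =>
      φ.coef i * (W (φ.right i).toNNReal ω - W (φ.left i).toNNReal ω)) Q :=
    fun i => ((hI _).sub (hI _)).const_mul _
  rw [integral_finsetSum _ fun i _ => hterm i]
  refine Finset.sum_eq_zero fun i _ => ?_
  rw [integral_const_mul, integral_sub (hI _) (hI _), hW.integral_eval, hW.integral_eval]
  simp

theorem isGaussianProcess_wienerIntegral {Ω ι : Type*} [MeasurableSpace Ω] {Q : Measure Ω}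
    {W : ℝ≥0 → Ω → ℝ} (hW : IsPreBrownianReal W Q) {s t : ι → ℝ}
    (φ : ∀ i, StepFun (s i) (t i)) :
    IsGaussianProcess (fun i => (φ i).wienerIntegral W) Q := by
  classical
  refine hW.isGaussianProcess.of_isGaussianProcess fun i => ?_
  set R : Finset ℝ≥0 := Finset.univ.image (fun j => ((φ i).right j).toNNReal)
  set L : Finset ℝ≥0 := Finset.univ.image (fun j => ((φ i).left j).toNNReal)
  have hR : ∀ j, ((φ i).right j).toNNReal ∈ R ∪ L := fun j =>
    Finset.mem_union_left _ (Finset.mem_image_of_mem _ (Finset.mem_univ j))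
  have hL : ∀ j, ((φ i).left j).toNNReal ∈ R ∪ L := fun j =>
    Finset.mem_union_right _ (Finset.mem_image_of_mem _ (Finset.mem_univ j))
  exact ⟨R ∪ L, ∑ j, (φ i).coef j • (ContinuousLinearMap.proj ⟨_, hR j⟩
    - ContinuousLinearMap.proj ⟨_, hL j⟩), fun ω => by simp [StepFun.wienerIntegral]⟩

/-! ### The Wiener integral process as a Gaussian process -/

namespace IsWienerIntegralProcess

variable {Ω : Type*} [MeasurableSpace Ω] {Q : Measure Ω} {W : ℝ≥0 → Ω → ℝ} {f : ℝ → ℝ} {t₀ T : ℝ}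
  {M : ℝ → Ω → ℝ}

theorem isGaussianProcess (hM : IsWienerIntegralProcess Q W f t₀ T M)
    (hW : IsPreBrownianReal W Q) : IsGaussianProcess (fun s : Icc t₀ T => M s) Q := by
  have := hW.isGaussianProcess.isProbabilityMeasure
  choose φ _ hφ using fun s : Icc t₀ T => (hM.isWienerIntegral s s.2).exists_approx
  exact isGaussianProcess_of_tendsto_eLpNorm
    (fun k => isGaussianProcess_wienerIntegral hW fun s => φ s k)
    (fun s => (hM.isWienerIntegral s s.2).memLp) hφ

theorem integral_eq_zero (hM : IsWienerIntegralProcess Q W f t₀ T M)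
    (hW : IsPreBrownianReal W Q) {s : ℝ} (hs : s ∈ Icc t₀ T) : ∫ ω, M s ω ∂Q = 0 := by
  have := hW.isGaussianProcess.isProbabilityMeasure
  obtain ⟨φ, _, hφ⟩ := (hM.isWienerIntegral s hs).exists_approx
  refine tendsto_nhds_unique (tendsto_integral_of_tendsto_eLpNorm_two
    (fun k => (φ k).memLp_wienerIntegral hW) (hM.isWienerIntegral s hs).memLp hφ) ?_
  simp [StepFun.integral_wienerIntegral hW]

theorem covariance_eq (hM : IsWienerIntegralProcess Q W f t₀ T M)
    (hW : IsPreBrownianReal W Q) (ht₀ : 0 ≤ t₀) {s t : ℝ} (hs : s ∈ Icc t₀ T)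
    (ht : t ∈ Icc t₀ T) (hst : s ≤ t) :
    cov[M s, M t; Q] = ∫ l in t₀..s, f l ^ 2 := by
  have := hW.isGaussianProcess.isProbabilityMeasure
  -- step functions vanish outside their interval, so they converge on all of `ℝ` to the truncation
  have key : ∀ s ∈ Icc t₀ T, MemLp ((Ioc t₀ s).indicator f) 2 volume ∧ ∃ φ : ℕ → StepFun t₀ s,
      Tendsto (fun k => eLpNorm ((φ k).eval - (Ioc t₀ s).indicator f) 2 volume) atTop (𝓝 0) ∧
      Tendsto (fun k => eLpNorm ((φ k).wienerIntegral W - M s) 2 Q) atTop (𝓝 0) := by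
    intro s hs
    obtain ⟨hf, -, φ, h1, h2⟩ := hM.isWienerIntegral s hs
    refine ⟨(memLp_indicator_iff_restrict measurableSet_Ioc).2 hf, φ, ?_, h2⟩
    refine h1.congr fun k => ?_
    rw [← eLpNorm_indicator_eq_eLpNorm_restrict measurableSet_Ioc]
    congr 1
    ext l
    by_cases hl : l ∈ Ioc t₀ s
    · simp [hl]
    · simp [hl, (φ k).eval_of_notMem hl]
  obtain ⟨hfs, φ, h1, h2⟩ := key s hs
  obtain ⟨hft, ψ, h3, h4⟩ := key t ht
  have hlim := tendsto_covariance_of_tendsto_eLpNorm (fun k => (φ k).memLp_wienerIntegral hW)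
    (fun k => (ψ k).memLp_wienerIntegral hW) (hM.isWienerIntegral s hs).memLp
    (hM.isWienerIntegral t ht).memLp h2 h4
  simp_rw [StepFun.covariance_wienerIntegral hW ht₀ ht₀] at hlim
  rw [tendsto_nhds_unique hlim (tendsto_integral_mul_of_tendsto_eLpNorm
    (fun k => (φ k).memLp_eval) (fun k => (ψ k).memLp_eval) hfs hft h1 h3),
    intervalIntegral.integral_of_le hs.1, ← integral_indicator measurableSet_Ioc]
  congr 1
  ext l
  by_cases hl : l ∈ Ioc t₀ s
  · have : l ∈ Ioc t₀ t := ⟨hl.1, hl.2.trans hst⟩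
    simp [hl, this, sq]
  · simp [hl]

end IsWienerIntegralProcess

/-! ### Drifted Brownian motion in a deterministic clock -/

/-- `X` is a continuous process on `[t₀, u]`, started at `0`, whose remaining increments
`X_u - X_s` are independent of the past up to time `s` and have law `N(β v(s), v(s))`, where
`v(s)` is the variance accumulated over `[s, u]`. -/
structure IsDriftedBrownian {Ω : Type*} [MeasurableSpace Ω] (Q : Measure Ω) (X : ℝ → Ω → ℝ)
    (β : ℝ) (v : ℝ → ℝ≥0) (t₀ u : ℝ) : Prop where
  le : t₀ ≤ u
  aemeasurable : ∀ s ∈ Icc t₀ u, AEMeasurable (X s) Q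
  indepFun : ∀ s ∈ Icc t₀ u,
    IndepFun (fun ω (l : Icc t₀ s) => X l ω) (fun ω => X u ω - X s ω) Q
  hasLaw : ∀ s ∈ Icc t₀ u, HasLaw (fun ω => X u ω - X s ω) (gaussianReal (β * v s) (v s)) Q
  ae_eq_zero : ∀ᵐ ω ∂Q, X t₀ ω = 0
  continuousOn : ∀ᵐ ω ∂Q, ContinuousOn (fun s => X s ω) (Icc t₀ u)

theorem gammaSq_self (V : ℝ → ℝ) (t₀ : ℝ) : gammaSq V t₀ t₀ = 0 :=
  intervalIntegral.integral_same

theorem gammaSq_sub {V : ℝ → ℝ} {t₀ T s t : ℝ}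
    (hV : IntegrableOn (fun l => Real.exp (2 * V l)) (Icc t₀ T))
    (hs : s ∈ Icc t₀ T) (ht : t ∈ Icc t₀ T) :
    gammaSq V t₀ t - gammaSq V t₀ s = ∫ l in s..t, Real.exp (2 * V l) := by
  have hI : ∀ a ∈ Icc t₀ T, IntervalIntegrable (fun l => Real.exp (2 * V l)) volume t₀ a := by
    intro a ha
    rw [intervalIntegrable_iff_integrableOn_Icc_of_le ha.1]
    exact hV.mono_set (Icc_subset_Icc_right ha.2)
  exact intervalIntegral.integral_interval_sub_left (hI t ht) (hI s hs)

theorem gammaSq_mono {V : ℝ → ℝ} {t₀ T s t : ℝ}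
    (hV : IntegrableOn (fun l => Real.exp (2 * V l)) (Icc t₀ T))
    (hs : s ∈ Icc t₀ T) (ht : t ∈ Icc t₀ T) (hst : s ≤ t) :
    gammaSq V t₀ s ≤ gammaSq V t₀ t := by
  rw [← sub_nonneg, gammaSq_sub hV hs ht]
  exact intervalIntegral.integral_nonneg hst fun _ _ => (Real.exp_pos _).le

theorem gammaSq_pos {V : ℝ → ℝ} {t₀ T u : ℝ}
    (hV : IntegrableOn (fun l => Real.exp (2 * V l)) (Icc t₀ T)) (hu : u ∈ Ioc t₀ T) :
    0 < gammaSq V t₀ u := by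
  refine intervalIntegral.intervalIntegral_pos_of_pos ?_ (fun _ => Real.exp_pos _) hu.1
  rw [intervalIntegrable_iff_integrableOn_Icc_of_le hu.1.le]
  exact hV.mono_set (Icc_subset_Icc_right hu.2)

theorem continuousOn_gammaSq {V : ℝ → ℝ} {t₀ T : ℝ} (h : t₀ ≤ T)
    (hV : IntegrableOn (fun l => Real.exp (2 * V l)) (Icc t₀ T)) :
    ContinuousOn (gammaSq V t₀) (Icc t₀ T) := by
  rw [← uIcc_of_le h] at hV ⊢
  exact intervalIntegral.continuousOn_primitive_interval hV

/-- The Wiener integral process with drift `β γ²` is a Brownian motion with drift `β` in the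
clock `γ²`: jointly Gaussian variables are independent once they are uncorrelated. -/
theorem IsWienerIntegralProcess.isDriftedBrownian {Ω : Type*} [MeasurableSpace Ω] {Q : Measure Ω}
    {W : ℝ≥0 → Ω → ℝ} {t₀ T : ℝ} {M : ℝ → Ω → ℝ} {V : ℝ → ℝ}
    (hM : IsWienerIntegralProcess Q W (fun l => Real.exp (V l)) t₀ T M)
    (hW : IsPreBrownianReal W Q) (ht₀ : 0 ≤ t₀)
    (hV : IntegrableOn (fun l => Real.exp (2 * V l)) (Icc t₀ T)) (β : ℝ) {u : ℝ}
    (hu : u ∈ Icc t₀ T) :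
    IsDriftedBrownian Q (fun s ω => M s ω + β * gammaSq V t₀ s) β
      (fun s => (gammaSq V t₀ u - gammaSq V t₀ s).toNNReal) t₀ u := by
  have := hW.isGaussianProcess.isProbabilityMeasure
  have hG := hM.isGaussianProcess hW
  have hsub : ∀ {s}, s ∈ Icc t₀ u → s ∈ Icc t₀ T := fun hs => ⟨hs.1, hs.2.trans hu.2⟩
  have hcov : ∀ {s t}, s ∈ Icc t₀ T → t ∈ Icc t₀ T → s ≤ t →
      cov[M s, M t; Q] = gammaSq V t₀ s := by
    intro s t hs ht hst
    rw [hM.covariance_eq hW ht₀ hs ht hst]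
    simp only [gammaSq, ← Real.exp_nat_mul, Nat.cast_ofNat]
  have hm : ∀ {s}, s ∈ Icc t₀ T → AEMeasurable (M s) Q := fun hs => hG.aemeasurable ⟨_, hs⟩
  have hL : ∀ {s}, s ∈ Icc t₀ T → MemLp (M s) 2 Q := fun hs => (hM.isWienerIntegral _ hs).memLp
  have hlaw : ∀ s ∈ Icc t₀ u, HasLaw (fun ω => M u ω - M s ω)
      (gaussianReal 0 (gammaSq V t₀ u - gammaSq V t₀ s).toNNReal) Q := by
    intro s hs
    have hsT := hsub hs
    have hg : HasGaussianLaw (fun ω => M u ω - M s ω) Q :=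
      hG.hasGaussianLaw_fun_sub (s := ⟨u, hu⟩) (t := ⟨s, hsT⟩)
    refine ⟨hg.aemeasurable, ?_⟩
    rw [hg.map_eq_gaussianReal, integral_sub ((hL hu).integrable one_le_two)
      ((hL hsT).integrable one_le_two), hM.integral_eq_zero hW hu, hM.integral_eq_zero hW hsT,
      sub_zero, ← covariance_self hg.aemeasurable,
      covariance_fun_sub_fun_sub (hL hu) (hL hsT) (hL hu) (hL hsT), hcov hu hu le_rfl,
      hcov hsT hsT le_rfl, hcov hsT hu hs.2, covariance_comm, hcov hsT hu hs.2]
    congr 2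
    ring
  refine ⟨hu.1, fun s hs => (hm (hsub hs)).add_const _, fun s hs => ?_, fun s hs => ?_, ?_, ?_⟩
  · have hsT := hsub hs
    have hlT : ∀ l : Icc t₀ s, (l : ℝ) ∈ Icc t₀ T := fun l => hsub ⟨l.2.1, l.2.2.trans hs.2⟩
    have key : IndepFun (fun ω (l : Icc t₀ s) => M l ω) (fun ω (_ : Unit) => M u ω - M s ω) Q := by
      refine IsGaussianProcess.indepFun_of_covariance_eq_zero (X := fun (l : Icc t₀ s) => M l)
        (Y := fun (_ : Unit) ω => M u ω - M s ω) ?_ (fun l => hm (hlT l))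
        (fun _ => (hm hu).sub (hm hsT)) fun l _ => ?_
      · classical
        refine hG.of_isGaussianProcess ?_
        rintro (l | -)
        · exact ⟨{⟨l, hlT l⟩}, ContinuousLinearMap.proj ⟨⟨l, hlT l⟩, by simp⟩, fun ω => by simp⟩
        · exact ⟨{⟨u, hu⟩, ⟨s, hsT⟩}, ContinuousLinearMap.proj ⟨⟨u, hu⟩, by simp⟩
            - ContinuousLinearMap.proj ⟨⟨s, hsT⟩, by simp⟩, fun ω => by simp⟩
      · rw [covariance_fun_sub_right (hL (hlT l)) (hL hu) (hL hsT),
          hcov (hlT l) hu (l.2.2.trans hs.2), hcov (hlT l) hsT l.2.2, sub_self]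
    have h2 := key.comp (φ := fun x (l : Icc t₀ s) => x l + β * gammaSq V t₀ l)
      (ψ := fun x => x () + (β * gammaSq V t₀ u - β * gammaSq V t₀ s)) (by fun_prop) (by fun_prop)
    convert! h2 using 1
    ext ω
    simp only [Function.comp_apply]
    ring
  · have h := gaussianReal_add_const (hlaw s hs) (β * (gammaSq V t₀ u - gammaSq V t₀ s))
    rw [Real.coe_toNNReal _ (sub_nonneg.2 (gammaSq_mono hV (hsub hs) hu hs.2))]
    convert! h using 1
    · ext ω; ring
    · rw [zero_add]
  · have ht : t₀ ∈ Icc t₀ T := ⟨le_rfl, hu.1.trans hu.2⟩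
    have hz : Var[M t₀; Q] = 0 := by
      rw [← covariance_self (hm ht), hcov ht ht le_rfl, gammaSq_self]
    have hd : HasLaw (M t₀) (Measure.dirac 0) Q := by
      refine ⟨hm ht, ?_⟩
      have hg : HasGaussianLaw (M t₀) Q := hG.hasGaussianLaw_eval ⟨t₀, ht⟩
      rw [hg.map_eq_gaussianReal, hz, hM.integral_eq_zero hW ht]
      simp
    filter_upwards [hd.ae_eq_of_dirac] with ω hω
    simp [hω, gammaSq_self]
  · filter_upwards [hM.continuousOn] with ω hω
    exact (hω.add ((continuousOn_gammaSq (hu.1.trans hu.2) hV).const_mul β)).mono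
      (Icc_subset_Icc_right hu.2)

/-! ### Grid approximation of the first passage of a continuous path -/

/-- The `k`-th point of the uniform grid with `n + 1` cells on `[t₀, u]`. -/
noncomputable def gridPoint (t₀ u : ℝ) (n k : ℕ) : ℝ :=
  t₀ + (u - t₀) * (k / (n + 1))

theorem gridPoint_zero (t₀ u : ℝ) (n : ℕ) : gridPoint t₀ u n 0 = t₀ := by
  simp [gridPoint]

theorem gridPoint_mono {t₀ u : ℝ} (h : t₀ ≤ u) (n : ℕ) : Monotone (gridPoint t₀ u n) := by
  intro i j hij
  have : 0 ≤ u - t₀ := sub_nonneg.2 h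
  unfold gridPoint
  gcongr

theorem gridPoint_mem {t₀ u : ℝ} (h : t₀ ≤ u) {n k : ℕ} (hk : k ≤ n + 1) :
    gridPoint t₀ u n k ∈ Icc t₀ u := by
  refine ⟨by simpa [gridPoint_zero] using gridPoint_mono h n (Nat.zero_le k), ?_⟩
  refine (gridPoint_mono h n hk).trans (le_of_eq ?_)
  have : (n : ℝ) + 1 ≠ 0 := by positivity
  simp [gridPoint, div_self this]

theorem gridPoint_succ_sub (t₀ u : ℝ) (n k : ℕ) :
    gridPoint t₀ u n (k + 1) - gridPoint t₀ u n k = (u - t₀) / (n + 1) := by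
  simp only [gridPoint, Nat.cast_add, Nat.cast_one]
  ring

theorem exists_gridPoint_near {t₀ u s : ℝ} (h : t₀ < u) (hs : s ∈ Icc t₀ u) (n : ℕ) :
    ∃ k ≤ n + 1, |gridPoint t₀ u n k - s| ≤ (u - t₀) / (n + 1) := by
  have hu : 0 < u - t₀ := sub_pos.2 h
  have hn : (0 : ℝ) < n + 1 := by positivity
  set q : ℝ := (s - t₀) / (u - t₀) * (n + 1)
  have hq0 : 0 ≤ q := mul_nonneg (div_nonneg (sub_nonneg.2 hs.1) hu.le) hn.le
  have hq1 : q ≤ n + 1 := by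
    refine mul_le_of_le_one_left hn.le ((div_le_one hu).2 ?_)
    linarith [hs.2]
  refine ⟨⌊q⌋₊, Nat.floor_le_of_le (by exact_mod_cast hq1), ?_⟩
  have h1 := Nat.floor_le hq0
  have h2 := Nat.lt_floor_add_one q
  have hsq : s = t₀ + (u - t₀) * (q / (n + 1)) := by
    simp only [q]
    field_simp
    ring
  have hd : gridPoint t₀ u n ⌊q⌋₊ - s = (u - t₀) / (n + 1) * (⌊q⌋₊ - q) := by
    rw [hsq, gridPoint]
    ring
  rw [hd, abs_mul, abs_of_pos (div_pos hu hn)]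
  refine mul_le_of_le_one_right (div_pos hu hn).le ?_
  rw [abs_le]
  constructor <;> linarith

/-- `k` is the first index at which the sequence `y` is below the level `b`. -/
def IsFirstBelow (b : ℝ) (y : ℕ → ℝ) (k : ℕ) : Prop :=
  y k < b ∧ ∀ i < k, b ≤ y i

theorem IsFirstBelow.eq {b : ℝ} {y : ℕ → ℝ} {j k : ℕ} (hj : IsFirstBelow b y j)
    (hk : IsFirstBelow b y k) : j = k := by
  rcases lt_trichotomy j k with h | h | h
  · exact absurd hj.1 (not_lt.2 (hk.2 j h))
  · exact h
  · exact absurd hk.1 (not_lt.2 (hj.2 k h))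

theorem exists_isFirstBelow {b : ℝ} {y : ℕ → ℝ} {n : ℕ} (h : ∃ k ≤ n, y k < b) :
    ∃ k ≤ n, IsFirstBelow b y k := by
  classical
  obtain ⟨k, hk, hy⟩ := h
  have hex : ∃ k, y k < b := ⟨k, hy⟩
  exact ⟨Nat.find hex, (Nat.find_min' hex hy).trans hk, Nat.find_spec hex,
    fun i hi => not_lt.1 (Nat.find_min hex hi)⟩

open Classical in
/-- The value of `h` at the first of `y 0, …, y n` below `b`, and `0` if there is none. -/
noncomputable def passageValue (b : ℝ) (y : ℕ → ℝ) (n : ℕ) (h : ℝ → ℝ) : ℝ :=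
  ∑ k ∈ Finset.range (n + 1), if IsFirstBelow b y k then h (y k) else 0

theorem passageValue_eq {b : ℝ} {y : ℕ → ℝ} {n k : ℕ} (hk : k ≤ n) (hf : IsFirstBelow b y k)
    (h : ℝ → ℝ) : passageValue b y n h = h (y k) := by
  rw [passageValue, Finset.sum_eq_single k]
  · simp [hf]
  · intro j _ hjk
    rw [if_neg fun hj => hjk (hj.eq hf)]
  · intro hk'
    exact absurd (Finset.mem_range.2 (Nat.lt_succ_of_le hk)) hk'

theorem passageValue_eq_zero {b : ℝ} {y : ℕ → ℝ} {n : ℕ} (hn : ¬ ∃ k ≤ n, y k < b) (h : ℝ → ℝ) :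
    passageValue b y n h = 0 := by
  refine Finset.sum_eq_zero fun k hk => if_neg fun hf => hn ⟨k, ?_, hf.1⟩
  exact Nat.lt_succ_iff.1 (Finset.mem_range.1 hk)

theorem abs_passageValue_le {b : ℝ} {y : ℕ → ℝ} {n : ℕ} {h : ℝ → ℝ} {C : ℝ} (hC : ∀ z, |h z| ≤ C) :
    |passageValue b y n h| ≤ C := by
  by_cases hn : ∃ k ≤ n, y k < b
  · obtain ⟨k, hk, hf⟩ := exists_isFirstBelow hn
    rw [passageValue_eq hk hf]
    exact hC _
  · rw [passageValue_eq_zero hn, abs_zero]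
    exact (abs_nonneg _).trans (hC 0)

theorem exists_mesh_uniform {x : ℝ → ℝ} {t₀ u : ℝ} (hx : ContinuousOn x (Icc t₀ u)) {ε : ℝ}
    (hε : 0 < ε) : ∀ᶠ n : ℕ in atTop, ∀ p ∈ Icc t₀ u, ∀ q ∈ Icc t₀ u,
      |p - q| ≤ (u - t₀) / (n + 1) → |x p - x q| < ε := by
  obtain ⟨δ, hδ, h⟩ := Metric.uniformContinuousOn_iff.1
    (isCompact_Icc.uniformContinuousOn_of_continuous hx) ε hε
  have hlim : Tendsto (fun n : ℕ => (u - t₀) / ((n : ℝ) + 1)) atTop (𝓝 0) :=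
    tendsto_const_nhds.div_atTop (tendsto_natCast_atTop_atTop.atTop_add tendsto_const_nhds)
  filter_upwards [hlim.eventually (gt_mem_nhds hδ)] with n hn p hp q hq hpq
  exact h p hp q hq (hpq.trans_lt hn)

theorem eventually_exists_gridPoint_lt_iff {x : ℝ → ℝ} {t₀ u b : ℝ} (htu : t₀ < u)
    (hx : ContinuousOn x (Icc t₀ u)) :
    ∀ᶠ n in atTop, (∃ k ≤ n + 1, x (gridPoint t₀ u n k) < b) ↔ ∃ s ∈ Icc t₀ u, x s < b := by
  by_cases hs : ∃ s ∈ Icc t₀ u, x s < b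
  · obtain ⟨s, hs, hxs⟩ := hs
    filter_upwards [exists_mesh_uniform hx (sub_pos.2 hxs)] with n hn
    refine iff_of_true ?_ ⟨s, hs, hxs⟩
    obtain ⟨k, hk, hks⟩ := exists_gridPoint_near htu hs n
    refine ⟨k, hk, ?_⟩
    have := abs_lt.1 (hn _ (gridPoint_mem htu.le hk) s hs hks)
    linarith [this.2]
  · refine Eventually.of_forall fun n => iff_of_false ?_ hs
    rintro ⟨k, hk, hxk⟩
    exact hs ⟨_, gridPoint_mem htu.le hk, hxk⟩

open Classical in
/-- Along a continuous path started above `b`, the overshoot at the first passage of the grid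
below `b` vanishes as the mesh tends to zero. -/
theorem tendsto_passageValue {x : ℝ → ℝ} {t₀ u b : ℝ} (htu : t₀ < u)
    (hx : ContinuousOn x (Icc t₀ u)) (hb : b ≤ x t₀) {h : ℝ → ℝ} (hh : ContinuousAt h b) :
    Tendsto (fun n => passageValue b (fun k => x (gridPoint t₀ u n k)) (n + 1) h) atTop
      (𝓝 (if ∃ s ∈ Icc t₀ u, x s < b then h b else 0)) := by
  have hgrid := eventually_exists_gridPoint_lt_iff (b := b) htu hx
  split_ifs with hs
  · rw [Metric.tendsto_nhds]
    intro ε hε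
    obtain ⟨δ, hδ, hhδ⟩ := Metric.continuousAt_iff.1 hh ε hε
    filter_upwards [hgrid, exists_mesh_uniform hx hδ] with n hn hmesh
    obtain ⟨k, hk, hf⟩ := exists_isFirstBelow (hn.2 hs)
    rw [passageValue_eq hk hf]
    refine hhδ ?_
    obtain ⟨h1, h2⟩ := hf
    cases k with
    | zero =>
      simp only [gridPoint_zero] at h1
      exact absurd h1 (not_lt.2 hb)
    | succ j =>
      have hj := h2 j (Nat.lt_succ_self j)
      have hd := hmesh _ (gridPoint_mem htu.le hk) _ (gridPoint_mem htu.le (Nat.le_of_succ_le hk))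
        (le_of_eq (by
          rw [gridPoint_succ_sub, abs_of_nonneg]
          exact div_nonneg (sub_nonneg.2 htu.le) (by positivity)))
      rw [Real.dist_eq, abs_lt]
      have := abs_lt.1 hd
      constructor <;> linarith [this.1]
  · refine tendsto_const_nhds.congr' ?_
    filter_upwards [hgrid] with n hn
    rw [passageValue_eq_zero fun hk => hs (hn.1 hk)]

/-! ### The reflection principle on a grid -/

/-- The law `N(βv, v)` tilted by `e^{-βz}` is symmetric, being proportional to `N(0, v)`. -/
theorem integral_exp_mul_gaussianReal_neg (β : ℝ) (v : ℝ≥0) (h : ℝ → ℝ) :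
    ∫ z, Real.exp (-β * z) * h z ∂gaussianReal (β * v) v
      = ∫ z, Real.exp (-β * z) * h (-z) ∂gaussianReal (β * v) v := by
  rcases eq_or_ne v 0 with rfl | hv
  · simp [gaussianReal_zero_var]
  · rw [integral_gaussianReal_eq_integral_smul hv, integral_gaussianReal_eq_integral_smul hv,
      ← integral_neg_eq_self]
    refine integral_congr_ae (Eventually.of_forall fun z => ?_)
    have hv' : (v : ℝ) ≠ 0 := by exact_mod_cast hv
    simp only [smul_eq_mul, gaussianPDFReal]
    rw [← mul_assoc, ← mul_assoc, mul_assoc _ (Real.exp _) (Real.exp _),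
      mul_assoc _ (Real.exp _) (Real.exp _), ← Real.exp_add, ← Real.exp_add]
    congr 3
    field_simp
    ring

/-- If the increment `Z ~ N(βv, v)` is independent of the past `F`, then under the weight
`e^{-β (p(F) + Z)}` it may be replaced by `-Z`. -/
theorem integral_exp_mul_reflect {Ω α : Type*} [MeasurableSpace Ω] [MeasurableSpace α]
    {Q : Measure Ω} [IsProbabilityMeasure Q] {F : Ω → α} {Z : Ω → ℝ} {β : ℝ} {v : ℝ≥0}
    (hF : AEMeasurable F Q) (hZ : HasLaw Z (gaussianReal (β * v) v) Q) (hFZ : IndepFun F Z Q)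
    {p : α → ℝ} (hp : Measurable p) {D : Set α} (hD : MeasurableSet D) {g : ℝ → ℝ}
    (hg : Measurable g) {C : ℝ} (hC : ∀ z, |g z| ≤ C)
    (hint : Integrable (fun ω => Real.exp (-β * (p (F ω) + Z ω))) Q) :
    ∫ ω, (F ⁻¹' D).indicator
        (fun ω => Real.exp (-β * (p (F ω) + Z ω)) * g (p (F ω) + Z ω)) ω ∂Q
      = ∫ ω, (F ⁻¹' D).indicator
        (fun ω => Real.exp (-β * (p (F ω) + Z ω)) * g (p (F ω) - Z ω)) ω ∂Q := by
  have hpair : AEMeasurable (fun ω => (F ω, Z ω)) Q := hF.prodMk hZ.aemeasurable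
  have hmap : Q.map (fun ω => (F ω, Z ω)) = (Q.map F).prod (gaussianReal (β * v) v) := by
    rw [hFZ.map_prod_eq_prod_map_map hF hZ.aemeasurable, hZ.map_eq]
  have key : ∀ h : α → ℝ → ℝ, Measurable (Function.uncurry h) → (∀ y z, |h y z| ≤ C) →
      ∫ ω, (F ⁻¹' D).indicator (fun ω => Real.exp (-β * (p (F ω) + Z ω)) * h (F ω) (Z ω)) ω ∂Q
        = ∫ y, D.indicator (fun y => Real.exp (-β * p y)) y *
            ∫ z, Real.exp (-β * z) * h y z ∂gaussianReal (β * v) v ∂(Q.map F) := by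
    intro h hh hhC
    set K : α × ℝ → ℝ := fun q => D.indicator (fun y => Real.exp (-β * p y)) q.1 *
      (Real.exp (-β * q.2) * h q.1 q.2) with hK
    have hKm : Measurable K := by
      have h1 : Measurable (D.indicator (fun y => Real.exp (-β * p y))) :=
        Measurable.indicator (by fun_prop) hD
      have h2 : Measurable (fun q : α × ℝ => h q.1 q.2) := hh
      fun_prop
    have hKF : ∀ ω, (F ⁻¹' D).indicator
        (fun ω => Real.exp (-β * (p (F ω) + Z ω)) * h (F ω) (Z ω)) ω = K (F ω, Z ω) := by
      intro ω
      by_cases hω : F ω ∈ D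
      · rw [indicator_of_mem (by exact hω)]
        simp only [hK, indicator_of_mem hω]
        rw [← mul_assoc, ← Real.exp_add, mul_add]
      · rw [indicator_of_notMem (by exact hω)]
        simp only [hK, indicator_of_notMem hω, zero_mul]
    have hKi : Integrable K ((Q.map F).prod (gaussianReal (β * v) v)) := by
      rw [← hmap, integrable_map_measure hKm.aestronglyMeasurable hpair]
      refine (hint.mul_const C).mono' (hKm.comp_aemeasurable hpair).aestronglyMeasurable
        (Eventually.of_forall fun ω => ?_)
      rw [Function.comp_apply, ← hKF, Real.norm_eq_abs]
      by_cases hω : F ω ∈ D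
      · rw [indicator_of_mem (by exact hω), abs_mul, Real.abs_exp]
        exact mul_le_mul_of_nonneg_left (hhC _ _) (Real.exp_pos _).le
      · rw [indicator_of_notMem (by exact hω), abs_zero]
        exact mul_nonneg (Real.exp_pos _).le ((abs_nonneg _).trans (hC 0))
    simp_rw [hKF]
    rw [← integral_map hpair hKm.aestronglyMeasurable, hmap, integral_prod _ hKi]
    simp only [hK, integral_const_mul]
  have h1 := key (fun y z => g (p y + z)) (by unfold Function.uncurry; fun_prop) fun _ _ => hC _
  have h2 := key (fun y z => g (p y - z)) (by unfold Function.uncurry; fun_prop) fun _ _ => hC _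
  refine h1.trans (Eq.trans ?_ h2.symm)
  congr 1
  ext y
  rw [integral_exp_mul_gaussianReal_neg β v fun z => g (p y + z)]
  simp only [sub_eq_add_neg]

namespace IsDriftedBrownian

variable {Ω : Type*} [MeasurableSpace Ω] {Q : Measure Ω}
  {X : ℝ → Ω → ℝ} {β : ℝ} {v : ℝ → ℝ≥0} {t₀ u : ℝ}

theorem hasLaw_terminal (hX : IsDriftedBrownian Q X β v t₀ u) :
    HasLaw (X u) (gaussianReal (β * v t₀) (v t₀)) Q := by
  refine (hX.hasLaw t₀ ⟨le_rfl, hX.le⟩).congr ?_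
  filter_upwards [hX.ae_eq_zero] with ω hω
  rw [hω, sub_zero]

theorem integrable_exp (hX : IsDriftedBrownian Q X β v t₀ u) :
    Integrable (fun ω => Real.exp (-β * X u ω)) Q := by
  have h := hX.hasLaw_terminal
  have hi := integrable_exp_mul_gaussianReal (μ := β * v t₀) (v := v t₀) (-β)
  rw [← h.map_eq] at hi
  exact (integrable_map_measure (by fun_prop) h.aemeasurable).1 hi

/-- Splitting over the first grid time below `b`, the remaining increment is reflected on each
piece: under the weight `e^{-βX_u}`, the terminal value may be reflected in the passage value. -/
theorem integral_passageValue [IsProbabilityMeasure Q] (hX : IsDriftedBrownian Q X β v t₀ u)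
    {b : ℝ} {g : ℝ → ℝ} (hg : Measurable g) {C : ℝ} (hC : ∀ z, |g z| ≤ C) (n : ℕ) :
    ∫ ω, Real.exp (-β * X u ω) *
        passageValue b (fun k => X (gridPoint t₀ u n k) ω) (n + 1) (fun _ => g (X u ω)) ∂Q
      = ∫ ω, Real.exp (-β * X u ω) *
        passageValue b (fun k => X (gridPoint t₀ u n k) ω) (n + 1)
          (fun y => g (2 * y - X u ω)) ∂Q := by
  classical
  have hmem : ∀ {k}, k ≤ n + 1 → gridPoint t₀ u n k ∈ Icc t₀ u := fun hk => gridPoint_mem hX.le hk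
  set y : Ω → ℕ → ℝ := fun ω k => X (gridPoint t₀ u n k) ω
  have hXu : AEMeasurable (X u) Q := hX.aemeasurable u ⟨hX.le, le_rfl⟩
  have key : ∀ k ≤ n + 1,
      (Integrable (fun ω => Real.exp (-β * X u ω) *
        if IsFirstBelow b (y ω) k then g (X u ω) else 0) Q ∧
      Integrable (fun ω => Real.exp (-β * X u ω) *
        if IsFirstBelow b (y ω) k then g (2 * y ω k - X u ω) else 0) Q) ∧
      ∫ ω, Real.exp (-β * X u ω) * (if IsFirstBelow b (y ω) k then g (X u ω) else 0) ∂Q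
        = ∫ ω, Real.exp (-β * X u ω) *
          (if IsFirstBelow b (y ω) k then g (2 * y ω k - X u ω) else 0) ∂Q := by
    intro k hk
    have hle : ∀ i : Iic k, gridPoint t₀ u n i ∈ Icc t₀ (gridPoint t₀ u n k) := fun i =>
      ⟨(hmem (i.2.trans hk)).1, gridPoint_mono hX.le n i.2⟩
    have hkk : k ∈ Iic k := mem_Iic.2 le_rfl
    set F : Ω → Iic k → ℝ := fun ω i => y ω i
    have hF : AEMeasurable F Q :=
      aemeasurable_pi_lambda _ fun i => hX.aemeasurable _ (hmem (i.2.trans hk))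
    have hres : Measurable fun (x : Icc t₀ (gridPoint t₀ u n k) → ℝ) (i : Iic k) =>
        x ⟨gridPoint t₀ u n i, hle i⟩ :=
      measurable_pi_lambda _ fun i => measurable_pi_apply _
    have hind : IndepFun F (fun ω => X u ω - y ω k) Q :=
      (hX.indepFun _ (hmem hk)).comp hres measurable_id
    set D : Set (Iic k → ℝ) :=
      {f | f ⟨k, hkk⟩ < b} ∩ ⋂ i : Iic k, ⋂ _ : (i : ℕ) < k, {f | b ≤ f i} with hDdef
    have hD : MeasurableSet D :=
      (measurableSet_lt (measurable_pi_apply _) measurable_const).inter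
        (MeasurableSet.iInter fun i => MeasurableSet.iInter fun _ =>
          measurableSet_le measurable_const (measurable_pi_apply _))
    have hDF : ∀ ω, IsFirstBelow b (y ω) k ↔ ω ∈ F ⁻¹' D := by
      intro ω
      simp only [hDdef, mem_preimage, mem_inter_iff, mem_iInter, mem_ofPred_eq, IsFirstBelow, F]
      exact and_congr_right fun _ => ⟨fun h i hi => h i hi, fun h i hi => h ⟨i, hi.le⟩ hi⟩
    have hDm : NullMeasurableSet (F ⁻¹' D) Q := hF.nullMeasurableSet_preimage hD
    have hrw : ∀ q : Ω → ℝ, (fun ω => Real.exp (-β * X u ω) *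
        (if IsFirstBelow b (y ω) k then q ω else 0))
        = (F ⁻¹' D).indicator (fun ω => Real.exp (-β * X u ω) * q ω) := by
      intro q
      ext ω
      by_cases hω : ω ∈ F ⁻¹' D
      · rw [if_pos ((hDF ω).2 hω), indicator_of_mem hω]
      · rw [if_neg fun h => hω ((hDF ω).1 h), indicator_of_notMem hω, mul_zero]
    have hI : ∀ q : Ω → ℝ, AEMeasurable q Q →
        Integrable ((F ⁻¹' D).indicator (fun ω => Real.exp (-β * X u ω) * g (q ω))) Q := by
      intro q hq
      refine Integrable.indicator₀ ?_ hDm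
      refine hX.integrable_exp.mul_bdd (c := C) (hg.comp_aemeasurable hq).aestronglyMeasurable ?_
      exact Eventually.of_forall fun ω => hC _
    have hyk : AEMeasurable (fun ω => y ω k) Q := hX.aemeasurable _ (hmem hk)
    have hrefl := integral_exp_mul_reflect hF (hX.hasLaw _ (hmem hk)) hind
      (p := fun f => f ⟨k, hkk⟩) (by fun_prop) hD hg hC
      (hX.integrable_exp.congr (Eventually.of_forall fun ω => by simp [F, y]))
    have h1 : ∀ ω, F ω ⟨k, hkk⟩ + (X u ω - X (gridPoint t₀ u n k) ω) = X u ω := fun ω =>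
      add_sub_cancel (F ω ⟨k, hkk⟩) _
    have h2 : ∀ ω, F ω ⟨k, hkk⟩ - (X u ω - X (gridPoint t₀ u n k) ω)
        = 2 * y ω k - X u ω := fun ω => by
      simp only [F, y]
      ring
    simp only [h1, h2] at hrefl
    simp_rw [hrw]
    exact ⟨⟨hI _ hXu, hI _ ((hyk.const_mul 2).sub hXu)⟩, hrefl⟩
  have hk : ∀ k ∈ Finset.range (n + 1 + 1), k ≤ n + 1 := fun k hk =>
    Nat.lt_succ_iff.1 (Finset.mem_range.1 hk)
  simp only [passageValue, Finset.mul_sum]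
  rw [integral_finsetSum _ fun k h => (key k (hk k h)).1.1,
    integral_finsetSum _ fun k h => (key k (hk k h)).1.2]
  exact Finset.sum_congr rfl fun k h => (key k (hk k h)).2

end IsDriftedBrownian

/-! ### The reflection principle in continuous time -/

/-- The event that the path goes strictly below `b` on `[t₀, u]`. -/
def belowEvent {Ω : Type*} (X : ℝ → Ω → ℝ) (t₀ u b : ℝ) : Set Ω :=
  {ω | ∃ s ∈ Icc t₀ u, X s ω < b}

/-- The event that the path reaches `b` or below on `[t₀, u]`. -/
def hitEvent {Ω : Type*} (X : ℝ → Ω → ℝ) (t₀ u b : ℝ) : Set Ω :=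
  {ω | ∃ s ∈ Icc t₀ u, X s ω ≤ b}

/-- For a continuous path, reaching `b` is the same as passing below every level of a sequence
decreasing strictly to `b`. -/
theorem eventually_exists_lt_iff_exists_le {x : ℝ → ℝ} {t₀ u b : ℝ} (htu : t₀ ≤ u)
    (hx : ContinuousOn x (Icc t₀ u)) {c : ℕ → ℝ} (hbc : ∀ n, b < c n)
    (hc : Tendsto c atTop (𝓝 b)) :
    ∀ᶠ n in atTop, (∃ s ∈ Icc t₀ u, x s < c n) ↔ ∃ s ∈ Icc t₀ u, x s ≤ b := by
  obtain ⟨p, hp, hmin⟩ := isCompact_Icc.exists_isMinOn (nonempty_Icc.2 htu) hx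
  rcases le_or_gt (x p) b with h | h
  · exact Eventually.of_forall fun n =>
      iff_of_true ⟨p, hp, h.trans_lt (hbc n)⟩ ⟨p, hp, h⟩
  · filter_upwards [hc.eventually (gt_mem_nhds h)] with n hn
    refine iff_of_false ?_ ?_
    · rintro ⟨s, hs, hxs⟩
      exact absurd (hmin hs) (not_le.2 (hxs.trans hn))
    · rintro ⟨s, hs, hxs⟩
      exact absurd (hmin hs) (not_le.2 (hxs.trans_lt h))

theorem exists_levels {b : ℝ} (hb : b < 0) :
    ∃ c : ℕ → ℝ, (∀ n, b < c n) ∧ (∀ n, c n < 0) ∧ Tendsto c atTop (𝓝 b) := by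
  obtain ⟨c, -, hc, hlim⟩ := exists_seq_strictAnti_tendsto' hb
  exact ⟨c, fun n => (hc n).1, fun n => (hc n).2, hlim⟩

namespace IsDriftedBrownian

variable {Ω : Type*} [MeasurableSpace Ω] {Q : Measure Ω}
  {X : ℝ → Ω → ℝ} {β : ℝ} {v : ℝ → ℝ≥0} {t₀ u : ℝ}

theorem nullMeasurableSet_belowEvent (hX : IsDriftedBrownian Q X β v t₀ u) (htu : t₀ < u) (b : ℝ) :
    NullMeasurableSet (belowEvent X t₀ u b) Q := by
  refine nullMeasurableSet_of_tendsto_indicator (L := atTop)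
    (As := fun n => ⋃ k ∈ Iic (n + 1), {ω | X (gridPoint t₀ u n k) ω < b}) (fun n => ?_) ?_
  · exact NullMeasurableSet.biUnion (to_countable _) fun k hk =>
      nullMeasurableSet_lt (hX.aemeasurable _ (gridPoint_mem htu.le hk)) aemeasurable_const
  · filter_upwards [hX.continuousOn] with ω hω
    filter_upwards [eventually_exists_gridPoint_lt_iff (b := b) htu hω] with n hn
    simpa [belowEvent] using hn

theorem nullMeasurableSet_hitEvent (hX : IsDriftedBrownian Q X β v t₀ u) (htu : t₀ < u) {b : ℝ}
    (hb : b < 0) : NullMeasurableSet (hitEvent X t₀ u b) Q := by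
  obtain ⟨c, hbc, -, hlim⟩ := exists_levels hb
  refine nullMeasurableSet_of_tendsto_indicator (L := atTop)
    (fun n => hX.nullMeasurableSet_belowEvent htu (c n)) ?_
  filter_upwards [hX.continuousOn] with ω hω
  exact eventually_exists_lt_iff_exists_le htu.le hω hbc hlim

/-- The reflection principle for the open event, obtained by letting the mesh tend to zero; the
weight `e^{-βX_u}` dominates all the integrands. -/
theorem setIntegral_belowEvent [IsProbabilityMeasure Q] (hX : IsDriftedBrownian Q X β v t₀ u)
    (htu : t₀ < u) {b : ℝ} (hb : b < 0) {g : ℝ → ℝ} (hg : Continuous g) {C : ℝ}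
    (hC : ∀ z, |g z| ≤ C) :
    ∫ ω in belowEvent X t₀ u b, Real.exp (-β * X u ω) * g (X u ω) ∂Q
      = ∫ ω in belowEvent X t₀ u b, Real.exp (-β * X u ω) * g (2 * b - X u ω) ∂Q := by
  classical
  have hXu : AEMeasurable (X u) Q := hX.aemeasurable u ⟨htu.le, le_rfl⟩
  have key : ∀ h : ℝ → ℝ → ℝ, Continuous (Function.uncurry h) → (∀ y z, |h y z| ≤ C) →
      Tendsto (fun n => ∫ ω, Real.exp (-β * X u ω) *
        passageValue b (fun k => X (gridPoint t₀ u n k) ω) (n + 1) (fun y => h y (X u ω)) ∂Q)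
        atTop (𝓝 (∫ ω in belowEvent X t₀ u b, Real.exp (-β * X u ω) * h b (X u ω) ∂Q)) := by
    intro h hh hhC
    rw [← integral_indicator₀ (hX.nullMeasurableSet_belowEvent htu b)]
    refine tendsto_integral_of_dominated_convergence (fun ω => Real.exp (-β * X u ω) * C)
      (fun n => ?_) (hX.integrable_exp.mul_const C) (fun n => ?_) ?_
    · refine (hX.integrable_exp.aestronglyMeasurable).mul ?_
      have hterm : ∀ k ≤ n + 1, AEMeasurable (fun ω =>
          if IsFirstBelow b (fun k => X (gridPoint t₀ u n k) ω) k
          then h (X (gridPoint t₀ u n k) ω) (X u ω) else 0) Q := by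
        intro k hk
        have hmem : ∀ i ≤ k, AEMeasurable (X (gridPoint t₀ u n i)) Q := fun i hi =>
          hX.aemeasurable _ (gridPoint_mem htu.le (hi.trans hk))
        have hS : NullMeasurableSet ({ω | X (gridPoint t₀ u n k) ω < b} ∩
            ⋂ i ∈ Iio k, {ω | b ≤ X (gridPoint t₀ u n i) ω}) Q :=
          (nullMeasurableSet_lt (hmem k le_rfl) aemeasurable_const).inter
            (NullMeasurableSet.biInter (to_countable _) fun i hi =>
              nullMeasurableSet_le aemeasurable_const (hmem i (le_of_lt hi)))
        have hq : AEMeasurable (fun ω => h (X (gridPoint t₀ u n k) ω) (X u ω)) Q :=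
          hh.measurable.comp_aemeasurable ((hmem k le_rfl).prodMk hXu)
        refine (hq.indicator₀ hS).congr (Eventually.of_forall fun ω => ?_)
        simp only [indicator_apply, mem_inter_iff, mem_ofPred_eq, mem_iInter, mem_Iio, IsFirstBelow]
        congr
      refine (Finset.aemeasurable_fun_sum _ fun k hk =>
        hterm k (Nat.lt_succ_iff.1 (Finset.mem_range.1 hk))).aestronglyMeasurable
    · refine Eventually.of_forall fun ω => ?_
      rw [Real.norm_eq_abs, abs_mul, Real.abs_exp]
      exact mul_le_mul_of_nonneg_left (abs_passageValue_le fun y => hhC y _) (Real.exp_pos _).le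
    · filter_upwards [hX.continuousOn, hX.ae_eq_zero] with ω hω h0
      have hcont : ContinuousAt (fun y => h y (X u ω)) b :=
        (hh.comp (by fun_prop : Continuous fun y : ℝ => (y, X u ω))).continuousAt
      have := (tendsto_passageValue htu hω (by rw [h0]; exact hb.le) hcont).const_mul
        (Real.exp (-β * X u ω))
      convert! this using 2
      by_cases hE : ω ∈ belowEvent X t₀ u b
      · rw [indicator_of_mem hE, if_pos (by exact hE)]
      · rw [indicator_of_notMem hE, if_neg (by exact hE), mul_zero]
  refine tendsto_nhds_unique (key (fun _ z => g z) (by unfold Function.uncurry; fun_prop)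
    fun _ _ => hC _) ?_
  refine (key (fun y z => g (2 * y - z)) (by unfold Function.uncurry; fun_prop)
    fun _ _ => hC _).congr fun n => ?_
  exact (hX.integral_passageValue hg.measurable hC n).symm

/-- The reflection principle for the closed event, obtained by approaching the level from above. -/
theorem setIntegral_hitEvent [IsProbabilityMeasure Q] (hX : IsDriftedBrownian Q X β v t₀ u)
    (htu : t₀ < u) {b : ℝ} (hb : b < 0) {g : ℝ → ℝ} (hg : Continuous g) {C : ℝ}
    (hC : ∀ z, |g z| ≤ C) :
    ∫ ω in hitEvent X t₀ u b, Real.exp (-β * X u ω) * g (X u ω) ∂Q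
      = ∫ ω in hitEvent X t₀ u b, Real.exp (-β * X u ω) * g (2 * b - X u ω) ∂Q := by
  have hXu : AEMeasurable (X u) Q := hX.aemeasurable u ⟨htu.le, le_rfl⟩
  obtain ⟨c, hbc, hc0, hlim⟩ := exists_levels hb
  have key : ∀ h : ℝ → ℝ → ℝ, Continuous (Function.uncurry h) → (∀ y z, |h y z| ≤ C) →
      Tendsto (fun n => ∫ ω in belowEvent X t₀ u (c n), Real.exp (-β * X u ω) * h (c n) (X u ω) ∂Q)
        atTop (𝓝 (∫ ω in hitEvent X t₀ u b, Real.exp (-β * X u ω) * h b (X u ω) ∂Q)) := by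
    intro h hh hhC
    rw [← integral_indicator₀ (hX.nullMeasurableSet_hitEvent htu hb)]
    simp_rw [fun n => (integral_indicator₀ (f := fun ω => Real.exp (-β * X u ω) * h (c n) (X u ω))
      (hX.nullMeasurableSet_belowEvent htu (c n))).symm]
    refine tendsto_integral_of_dominated_convergence (fun ω => Real.exp (-β * X u ω) * C)
      (fun n => ?_) (hX.integrable_exp.mul_const C) (fun n => ?_) ?_
    · have hq : AEMeasurable (fun ω => h (c n) (X u ω)) Q :=
        hh.measurable.comp_aemeasurable (aemeasurable_const.prodMk hXu)
      exact ((hX.integrable_exp.aestronglyMeasurable).mul hq.aestronglyMeasurable).indicator₀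
        (hX.nullMeasurableSet_belowEvent htu (c n))
    · refine Eventually.of_forall fun ω => (norm_indicator_le_norm_self _ _).trans ?_
      rw [Real.norm_eq_abs, abs_mul, Real.abs_exp]
      exact mul_le_mul_of_nonneg_left (hhC _ _) (Real.exp_pos _).le
    · filter_upwards [hX.continuousOn] with ω hω
      have hev := eventually_exists_lt_iff_exists_le htu.le hω hbc hlim
      have hcont : Tendsto (fun n => h (c n) (X u ω)) atTop (𝓝 (h b (X u ω))) :=
        ((hh.comp (by fun_prop : Continuous fun y : ℝ => (y, X u ω))).tendsto b).comp hlim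
      by_cases hE : ω ∈ hitEvent X t₀ u b
      · rw [indicator_of_mem hE]
        refine (hcont.const_mul _).congr' ?_
        filter_upwards [hev] with n hn
        rw [indicator_of_mem (show ω ∈ belowEvent X t₀ u (c n) from hn.2 hE)]
      · rw [indicator_of_notMem hE]
        refine tendsto_const_nhds.congr' ?_
        filter_upwards [hev] with n hn
        rw [indicator_of_notMem fun h' : ω ∈ belowEvent X t₀ u (c n) => hE (hn.1 h')]
  refine tendsto_nhds_unique (key (fun _ z => g z) (by unfold Function.uncurry; fun_prop)
    fun _ _ => hC _) ?_
  refine (key (fun y z => g (2 * y - z)) (by unfold Function.uncurry; fun_prop)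
    fun _ _ => hC _).congr fun n => ?_
  exact (hX.setIntegral_belowEvent htu (hc0 n) hg hC).symm

/-- On the event that the level `b` is reached, the law of `X_u` weighted by `e^{-βX_u}` is
invariant under reflection in `b`. -/
theorem setLIntegral_hitEvent [IsProbabilityMeasure Q] (hX : IsDriftedBrownian Q X β v t₀ u)
    (htu : t₀ < u) {b : ℝ} (hb : b < 0) {h : ℝ → ℝ≥0∞} (hh : Measurable h) :
    ∫⁻ ω in hitEvent X t₀ u b, ENNReal.ofReal (Real.exp (-β * X u ω)) * h (X u ω) ∂Q
      = ∫⁻ ω in hitEvent X t₀ u b,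
          ENNReal.ofReal (Real.exp (-β * X u ω)) * h (2 * b - X u ω) ∂Q := by
  have hXu : AEMeasurable (X u) Q := hX.aemeasurable u ⟨htu.le, le_rfl⟩
  set ρ : Measure Ω := (Q.restrict (hitEvent X t₀ u b)).withDensity
    (fun ω => ENNReal.ofReal (Real.exp (-β * X u ω))) with hρ
  have hw : AEMeasurable (fun ω => ENNReal.ofReal (Real.exp (-β * X u ω)))
      (Q.restrict (hitEvent X t₀ u b)) := by
    have := hXu.restrict (s := hitEvent X t₀ u b)
    fun_prop
  have hfin : IsFiniteMeasure ρ :=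
    isFiniteMeasure_withDensity_ofReal hX.integrable_exp.integrableOn.2
  have hXρ : AEMeasurable (X u) ρ :=
    (hXu.restrict (s := hitEvent X t₀ u b)).mono_ac (withDensity_absolutelyContinuous _ _)
  have hRρ : AEMeasurable (fun ω => 2 * b - X u ω) ρ := hXρ.const_sub _
  have hmap : ρ.map (X u) = ρ.map (fun ω => 2 * b - X u ω) := by
    refine ext_of_forall_integral_eq_of_IsFiniteMeasure fun f => ?_
    rw [integral_map hXρ f.continuous.aestronglyMeasurable,
      integral_map hRρ f.continuous.aestronglyMeasurable, hρ,
      integral_withDensity_eq_integral_toReal_smul₀ hw (by simp),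
      integral_withDensity_eq_integral_toReal_smul₀ hw (by simp)]
    simp only [ENNReal.toReal_ofReal (Real.exp_pos _).le, smul_eq_mul]
    exact hX.setIntegral_hitEvent htu hb f.continuous fun z => f.norm_coe_le_norm z
  have key : ∀ Y : Ω → ℝ, AEMeasurable Y ρ → ∫⁻ z, h z ∂(ρ.map Y)
      = ∫⁻ ω in hitEvent X t₀ u b, ENNReal.ofReal (Real.exp (-β * X u ω)) * h (Y ω) ∂Q := by
    intro Y hY
    rw [lintegral_map' hh.aemeasurable hY, hρ,
      lintegral_withDensity_eq_lintegral_mul_non_measurable₀ _ hw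
        (Eventually.of_forall fun _ => ENNReal.ofReal_lt_top)]
    rfl
  rw [← key _ hXρ, ← key _ hRρ, hmap]

end IsDriftedBrownian

/-! ### The law of the terminal value before the first passage -/

/-- The density of `X_u` on the event that a drifted Brownian motion with accumulated variance `v`
stays above `b`: the free density `N(βv, v)` minus its weighted image under reflection in `b`. -/
noncomputable def survivalDensity (β : ℝ) (v : ℝ≥0) (b y : ℝ) : ℝ :=
  gaussianPDFReal (β * v) v y - Real.exp (2 * β * b) * gaussianPDFReal (β * v) v (y - 2 * b)

theorem gaussianPDFReal_reflect (β : ℝ) {v : ℝ≥0} (hv : v ≠ 0) (b y : ℝ) :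
    gaussianPDFReal (β * v) v (2 * b - y) * (Real.exp (-β * (2 * b - y)) * Real.exp (β * y))
      = Real.exp (2 * β * b) * gaussianPDFReal (β * v) v (y - 2 * b) := by
  have hv' : (v : ℝ) ≠ 0 := by exact_mod_cast hv
  simp only [gaussianPDFReal]
  rw [mul_left_comm (Real.exp (2 * β * b)), mul_assoc, ← Real.exp_add, ← Real.exp_add,
    ← Real.exp_add]
  congr 2
  field_simp
  ring

theorem survivalDensity_nonneg (β : ℝ) (v : ℝ≥0) {b y : ℝ} (hb : b ≤ 0) (hy : b ≤ y) :
    0 ≤ survivalDensity β v b y := by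
  rcases eq_or_ne v 0 with rfl | hv
  · simp [survivalDensity]
  have hv' : (0 : ℝ) < v := by exact_mod_cast pos_iff_ne_zero.2 hv
  rw [survivalDensity, sub_nonneg]
  simp only [gaussianPDFReal]
  rw [mul_left_comm, ← Real.exp_add]
  refine mul_le_mul_of_nonneg_left (Real.exp_le_exp.2 ?_) (by positivity)
  -- the difference of the exponents is `2b(b - y)/v`
  have hdiff : -(y - β * v) ^ 2 / (2 * v) - (2 * β * b + -(y - 2 * b - β * v) ^ 2 / (2 * v))
      = 2 * (-b) * (y - b) / v := by
    field_simp
    ring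
  have : 0 ≤ 2 * (-b) * (y - b) / v :=
    div_nonneg (mul_nonneg (by linarith) (by linarith)) hv'.le
  linarith

namespace IsDriftedBrownian

variable {Ω : Type*} [MeasurableSpace Ω] {Q : Measure Ω} [IsProbabilityMeasure Q]
  {X : ℝ → Ω → ℝ} {β : ℝ} {v : ℝ → ℝ≥0} {t₀ u : ℝ}

/-- Above the level, the law of `X_u` on the event that the level has been reached: a set above `b`
is exchanged for its reflection, for which the event is automatic. -/
theorem measure_hitEvent_inter (hX : IsDriftedBrownian Q X β v t₀ u) (htu : t₀ < u)
    (hv : v t₀ ≠ 0) {b : ℝ} (hb : b < 0) {A : Set ℝ} (hA : MeasurableSet A) (hAb : A ⊆ Ioi b) :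
    Q (X u ⁻¹' A ∩ hitEvent X t₀ u b) = ∫⁻ y in A, ENNReal.ofReal
      (Real.exp (2 * β * b) * gaussianPDFReal (β * v t₀) (v t₀) (y - 2 * b)) := by
  have hXu : AEMeasurable (X u) Q := hX.aemeasurable u ⟨htu.le, le_rfl⟩
  have hH := hX.nullMeasurableSet_hitEvent htu hb
  have hXA : NullMeasurableSet (X u ⁻¹' A) Q := hXu.nullMeasurableSet_preimage hA
  set h : ℝ → ℝ≥0∞ := A.indicator fun y => ENNReal.ofReal (Real.exp (β * y)) with hh
  have hhm : Measurable h := Measurable.indicator (by fun_prop) hA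
  set G : ℝ → ℝ≥0∞ := fun x => ENNReal.ofReal (Real.exp (-β * x)) * h (2 * b - x) with hG
  have hGm : Measurable G := by fun_prop
  have hleft : ∫⁻ ω in hitEvent X t₀ u b, ENNReal.ofReal (Real.exp (-β * X u ω)) * h (X u ω) ∂Q
      = Q (X u ⁻¹' A ∩ hitEvent X t₀ u b) := by
    rw [← Measure.restrict_apply₀ (hXA.mono_ac Measure.restrict_le_self.absolutelyContinuous),
      ← lintegral_indicator_one₀ (hXA.mono_ac Measure.restrict_le_self.absolutelyContinuous)]
    refine lintegral_congr fun ω => ?_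
    by_cases hω : X u ω ∈ A
    · rw [indicator_of_mem (show ω ∈ X u ⁻¹' A from hω), hh, indicator_of_mem hω,
        ← ENNReal.ofReal_mul (Real.exp_pos _).le, ← Real.exp_add]
      simp
    · rw [indicator_of_notMem (show ω ∉ X u ⁻¹' A from hω), hh, indicator_of_notMem hω, mul_zero]
  -- reflecting `A` puts it below `b`, where the level has been reached at time `u`
  have hright : ∫⁻ ω in hitEvent X t₀ u b,
      ENNReal.ofReal (Real.exp (-β * X u ω)) * h (2 * b - X u ω) ∂Q = ∫⁻ ω, G (X u ω) ∂Q := by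
    rw [← lintegral_indicator₀ hH]
    refine lintegral_congr fun ω => ?_
    by_cases hω : ω ∈ hitEvent X t₀ u b
    · rw [indicator_of_mem hω]
    · rw [indicator_of_notMem hω, hG]
      have : 2 * b - X u ω ∉ A := fun hmem => hω ⟨u, ⟨htu.le, le_rfl⟩, by
        have := hAb hmem
        rw [mem_Ioi] at this
        linarith⟩
      simp only [hh, indicator_of_notMem this, mul_zero]
  rw [← hleft, hX.setLIntegral_hitEvent htu hb hhm, hright,
    ← lintegral_map' hGm.aemeasurable hXu, hX.hasLaw_terminal.map_eq,
    gaussianReal_of_var_ne_zero _ hv,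
    lintegral_withDensity_eq_lintegral_mul _ (measurable_gaussianPDF _ _) hGm,
    ← lintegral_sub_left_eq_self _ (2 * b), ← lintegral_indicator hA]
  refine lintegral_congr fun y => ?_
  simp only [Pi.mul_apply, hG, hh, sub_sub_cancel]
  by_cases hy : y ∈ A
  · rw [indicator_of_mem hy, indicator_of_mem hy, ← gaussianPDFReal_reflect β hv, gaussianPDF,
      ENNReal.ofReal_mul (gaussianPDFReal_nonneg _ _ _), ENNReal.ofReal_mul (Real.exp_pos _).le]
  · rw [indicator_of_notMem hy, indicator_of_notMem hy, mul_zero, mul_zero]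

theorem measure_survival (hX : IsDriftedBrownian Q X β v t₀ u) (htu : t₀ < u)
    (hv : v t₀ ≠ 0) {b : ℝ} (hb : b < 0) {A : Set ℝ} (hA : MeasurableSet A) :
    Q (X u ⁻¹' A ∩ (hitEvent X t₀ u b)ᶜ)
      = ∫⁻ y in A ∩ Ioi b, ENNReal.ofReal (survivalDensity β (v t₀) b y) := by
  have hXu : AEMeasurable (X u) Q := hX.aemeasurable u ⟨htu.le, le_rfl⟩
  have hH := hX.nullMeasurableSet_hitEvent htu hb
  have hAb : MeasurableSet (A ∩ Ioi b) := hA.inter measurableSet_Ioi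
  have hset : X u ⁻¹' A ∩ (hitEvent X t₀ u b)ᶜ
      = X u ⁻¹' (A ∩ Ioi b) \ (X u ⁻¹' (A ∩ Ioi b) ∩ hitEvent X t₀ u b) := by
    ext ω
    simp only [mem_inter_iff, mem_preimage, mem_compl_iff, Set.mem_sdiff, mem_Ioi]
    have : ω ∉ hitEvent X t₀ u b → b < X u ω := fun h =>
      not_le.1 fun hle => h ⟨u, ⟨htu.le, le_rfl⟩, hle⟩
    tauto
  have hfree : Q (X u ⁻¹' (A ∩ Ioi b))
      = ∫⁻ y in A ∩ Ioi b, ENNReal.ofReal (gaussianPDFReal (β * v t₀) (v t₀) y) := by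
    rw [← Measure.map_apply_of_aemeasurable hXu hAb, hX.hasLaw_terminal.map_eq,
      gaussianReal_apply _ hv]
    rfl
  have hrefl := hX.measure_hitEvent_inter htu hv hb hAb inter_subset_right
  rw [hset, measure_sdiff inter_subset_left
    ((hXu.nullMeasurableSet_preimage hAb).inter hH) (measure_ne_top _ _), hfree, hrefl,
    ← lintegral_sub' (by fun_prop)]
  · refine lintegral_congr fun y => ?_
    rw [survivalDensity, ENNReal.ofReal_sub _
      (mul_nonneg (Real.exp_pos _).le (gaussianPDFReal_nonneg _ _ _))]
  · rw [← hrefl]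
    exact measure_ne_top _ _
  · refine (ae_restrict_iff' hAb).2 (Eventually.of_forall fun y hy => ?_)
    refine ENNReal.ofReal_le_ofReal (sub_nonneg.1 ?_)
    exact survivalDensity_nonneg β (v t₀) hb.le (le_of_lt hy.2)

end IsDriftedBrownian

/-! ### From the drifted Brownian motion to the geometric Brownian motion -/

theorem barrier_pos {H₁ : ℝ} (hH₁ : 0 < H₁) (r β : ℝ) (V : ℝ → ℝ) (t₀ T s : ℝ) :
    0 < barrier H₁ r β V t₀ T s :=
  mul_pos hH₁ (Real.exp_pos _)

/-- The constant shift between `log S_u` and the drifted process `M_u + β γ²(u)`. -/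
noncomputable def logShift (x r β : ℝ) (V : ℝ → ℝ) (t₀ u : ℝ) : ℝ :=
  Real.log x + r * (u - t₀) - (1 / 2 + β) * gammaSq V t₀ u

theorem gbm_eq_exp {Ω : Type*} {x : ℝ} (hx : 0 < x) (r β : ℝ) (V : ℝ → ℝ) (t₀ : ℝ)
    (M : ℝ → Ω → ℝ) (u : ℝ) (ω : Ω) :
    gbm x r V t₀ M u ω
      = Real.exp (logShift x r β V t₀ u + (M u ω + β * gammaSq V t₀ u)) := by
  rw [gbm, logShift]
  nth_rewrite 1 [← Real.exp_log hx]
  rw [← Real.exp_add]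
  congr 1
  ring

/-- The barrier is, up to the same shift, the constant level `log (Ĥ(t₀) / x)`. -/
theorem barrier_eq_exp {x H₁ : ℝ} (hx : 0 < x) (hH₁ : 0 < H₁) (r β : ℝ) (V : ℝ → ℝ) (t₀ T u : ℝ) :
    barrier H₁ r β V t₀ T u = Real.exp (logShift x r β V t₀ u
      + Real.log (barrier H₁ r β V t₀ T t₀ / x)) := by
  rw [Real.log_div (barrier_pos hH₁ _ _ _ _ _ _).ne' hx.ne', barrier, barrier,
    Real.log_mul hH₁.ne' (Real.exp_pos _).ne', Real.log_exp, logShift, gammaSq_self]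
  nth_rewrite 1 [← Real.exp_log hH₁]
  rw [← Real.exp_add]
  congr 1
  ring

/-- If, along a path, lying on or below the barrier means that a continuous function `y` is at most
`b`, then `u < τ` says that `y` stays above `b` up to time `u`. -/
theorem lt_hitTime_iff {Ω : Type*} {S : ℝ → Ω → ℝ} {H : ℝ → ℝ} {t₀ T u : ℝ} {ω : Ω} {y : ℝ → ℝ}
    {b : ℝ} (hS : ∀ s, S s ω ≤ H s ↔ y s ≤ b) (hy : ContinuousOn y (Icc t₀ T)) (hu : u ≤ T) :
    (u : EReal) < hitTime S H t₀ T ω ↔ ¬ ∃ s ∈ Icc t₀ u, y s ≤ b := by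
  constructor
  · rintro h ⟨s, hs, hys⟩
    refine absurd h (not_lt.2 ?_)
    exact (sInf_le (mem_image_of_mem (fun u : ℝ => (u : EReal))
      (show s ∈ {s : ℝ | s ∈ Icc t₀ T ∧ S s ω ≤ H s} from
        ⟨⟨hs.1, hs.2.trans hu⟩, (hS s).2 hys⟩))).trans (EReal.coe_le_coe_iff.2 hs.2)
  · intro h
    set A : Set ℝ := {s : ℝ | s ∈ Icc t₀ T ∧ S s ω ≤ H s} with hA
    have hAeq : A = Icc t₀ T ∩ y ⁻¹' Iic b := by
      ext s
      simp [hA, hS]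
    rcases A.eq_empty_or_nonempty with he | hne
    · rw [hitTime, ← hA, he, image_empty, sInf_empty]
      exact EReal.coe_lt_top u
    · -- the infimum is attained, because the hitting set is closed
      have hc : IsCompact A := by
        rw [hAeq]
        exact isCompact_Icc.of_isClosed_subset
          (hy.preimage_isClosed_of_isClosed isClosed_Icc isClosed_Iic) inter_subset_left
      obtain ⟨p, hp, hmin⟩ := hc.exists_isLeast hne
      have hup : u < p := by
        by_contra hle
        exact h ⟨p, ⟨hp.1.1, not_lt.1 hle⟩, (hS p).1 hp.2⟩
      refine (EReal.coe_lt_coe_iff.2 hup).trans_le (le_sInf ?_)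
      rintro _ ⟨s, hs, rfl⟩
      exact EReal.coe_le_coe_iff.2 (hmin hs)

theorem gaussianPDFReal_standardize (m y : ℝ) {v : ℝ} (hv : 0 < v) :
    1 / √v * gaussianPDFReal 0 1 ((y - m) / √v) = gaussianPDFReal m v.toNNReal y := by
  simp only [gaussianPDFReal, Real.coe_toNNReal v hv.le, NNReal.coe_one, mul_one, sub_zero]
  rw [Real.sqrt_mul (by positivity : (0 : ℝ) ≤ 2 * Real.pi) v, mul_inv, div_pow,
    Real.sq_sqrt hv.le, ← mul_assoc, one_div, mul_comm (√v)⁻¹]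
  congr 2
  field_simp

/-- In the logarithmic coordinate `w = e^{k + y}` the joint density is the survival density of the
drifted Brownian motion. -/
theorem jointDensity_exp {x r H₁ β : ℝ} {V : ℝ → ℝ} {t₀ T u : ℝ} (hx : 0 < x) (hH₁ : 0 < H₁)
    (hv : 0 < gammaSq V t₀ u) {y : ℝ}
    (hy : Real.log (barrier H₁ r β V t₀ T t₀ / x) < y) :
    Real.exp (logShift x r β V t₀ u + y) * jointDensity x r H₁ β V t₀ T u
        (Real.exp (logShift x r β V t₀ u + y))
      = survivalDensity β (gammaSq V t₀ u).toNNReal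
          (Real.log (barrier H₁ r β V t₀ T t₀ / x)) y := by
  have hH := barrier_pos hH₁ r β V t₀ T t₀
  set k := logShift x r β V t₀ u with hk
  set b := Real.log (barrier H₁ r β V t₀ T t₀ / x) with hb
  have hmem : Real.exp (k + y) ∈ Ioi (barrier H₁ r β V t₀ T u) := by
    rw [mem_Ioi, barrier_eq_exp hx hH₁]
    exact Real.exp_lt_exp.2 (by linarith)
  have hμ₁ : k + y - logMean r V t₀ u x = y - β * gammaSq V t₀ u := by
    simp only [hk, logShift, logMean]
    ring
  have hμ₂ : k + y - logMean r V t₀ u (barrier H₁ r β V t₀ T t₀ ^ 2 / x)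
      = y - 2 * b - β * gammaSq V t₀ u := by
    simp only [hk, hb, logShift, logMean]
    rw [Real.log_div (pow_pos hH 2).ne' hx.ne', Real.log_div hH.ne' hx.ne', Real.log_pow]
    push_cast
    ring
  have hpow : (barrier H₁ r β V t₀ T t₀ / x) ^ (2 * β) = Real.exp (2 * β * b) := by
    rw [Real.rpow_def_of_pos (div_pos hH hx), mul_comm]
  simp only [jointDensity]
  rw [indicator_of_mem hmem, Real.log_exp, hμ₁, hμ₂, hpow, survivalDensity,
    Real.coe_toNNReal _ hv.le, ← gaussianPDFReal_standardize _ _ hv,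
    ← gaussianPDFReal_standardize _ _ hv]
  have hγ : √(gammaSq V t₀ u) ≠ 0 := (Real.sqrt_pos.2 hv).ne'
  have he := (Real.exp_pos (k + y)).ne'
  field_simp

theorem exp_add_image_Ioi (k b : ℝ) :
    (fun y => Real.exp (k + y)) '' Ioi b = Ioi (Real.exp (k + b)) := by
  ext w
  constructor
  · rintro ⟨y, hy, rfl⟩
    exact Real.exp_lt_exp.2 (by simpa using hy)
  · intro hw
    have hw0 : 0 < w := (Real.exp_pos _).trans hw
    refine ⟨Real.log w - k, ?_, by simp [Real.exp_log hw0]⟩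
    rw [mem_Ioi, lt_sub_iff_add_lt']
    exact (Real.lt_log_iff_exp_lt hw0).2 hw

theorem jointDensity_nonneg {x r H₁ β : ℝ} {V : ℝ → ℝ} {t₀ T u : ℝ} (hx : 0 < x) (hH₁ : 0 < H₁)
    (hHx : barrier H₁ r β V t₀ T t₀ < x) (hv : 0 < gammaSq V t₀ u) (w : ℝ) :
    0 ≤ jointDensity x r H₁ β V t₀ T u w := by
  by_cases hw : w ∈ Ioi (barrier H₁ r β V t₀ T u)
  · rw [barrier_eq_exp hx hH₁, ← exp_add_image_Ioi] at hw
    obtain ⟨y, hy, rfl⟩ := hw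
    have h := jointDensity_exp hx hH₁ hv hy
    have hb : Real.log (barrier H₁ r β V t₀ T t₀ / x) ≤ 0 :=
      Real.log_nonpos (div_pos (barrier_pos hH₁ _ _ _ _ _ _) hx).le ((div_le_one hx).2 hHx.le)
    have := survivalDensity_nonneg β (gammaSq V t₀ u).toNNReal hb (le_of_lt hy)
    rw [← h] at this
    exact nonneg_of_mul_nonneg_right this (Real.exp_pos _)
  · simp only [jointDensity]
    rw [indicator_of_notMem hw]

theorem setLIntegral_jointDensity {x r H₁ β : ℝ} {V : ℝ → ℝ} {t₀ T u : ℝ} (hx : 0 < x)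
    (hH₁ : 0 < H₁) (hv : 0 < gammaSq V t₀ u) {B : Set ℝ} (hB : MeasurableSet B) :
    ∫⁻ w in B, ENNReal.ofReal (jointDensity x r H₁ β V t₀ T u w)
      = ∫⁻ y in (fun y => Real.exp (logShift x r β V t₀ u + y)) ⁻¹' B
            ∩ Ioi (Real.log (barrier H₁ r β V t₀ T t₀ / x)),
          ENNReal.ofReal (survivalDensity β (gammaSq V t₀ u).toNNReal
            (Real.log (barrier H₁ r β V t₀ T t₀ / x)) y) := by
  set k := logShift x r β V t₀ u with hk
  set b := Real.log (barrier H₁ r β V t₀ T t₀ / x) with hb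
  have hpre : MeasurableSet ((fun y => Real.exp (k + y)) ⁻¹' B) :=
    (by fun_prop : Measurable fun y => Real.exp (k + y)) hB
  have hrestrict : ∫⁻ w in B, ENNReal.ofReal (jointDensity x r H₁ β V t₀ T u w)
      = ∫⁻ w in Ioi (barrier H₁ r β V t₀ T u),
          B.indicator (fun w => ENNReal.ofReal (jointDensity x r H₁ β V t₀ T u w)) w := by
    rw [← lintegral_indicator hB, ← lintegral_indicator measurableSet_Ioi]
    refine lintegral_congr fun w => ?_
    by_cases hw : w ∈ Ioi (barrier H₁ r β V t₀ T u)
    · rw [indicator_of_mem hw]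
    · rw [indicator_of_notMem hw]
      have h0 : jointDensity x r H₁ β V t₀ T u w = 0 := by
        simp only [jointDensity]
        rw [indicator_of_notMem hw]
      by_cases hwB : w ∈ B
      · rw [indicator_of_mem hwB, h0, ENNReal.ofReal_zero]
      · rw [indicator_of_notMem hwB]
  have hderiv : ∀ y ∈ Ioi b, HasDerivWithinAt (fun y => Real.exp (k + y)) (Real.exp (k + y))
      (Ioi b) y := fun y _ => by
    simpa using (((hasDerivAt_id y).const_add k).exp).hasDerivWithinAt
  have hinj : InjOn (fun y => Real.exp (k + y)) (Ioi b) := fun y _ z _ h =>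
    add_left_cancel (Real.exp_injective h)
  rw [hrestrict, barrier_eq_exp hx hH₁, ← exp_add_image_Ioi,
    lintegral_image_eq_lintegral_abs_deriv_mul measurableSet_Ioi hderiv hinj,
    ← lintegral_indicator measurableSet_Ioi,
    ← lintegral_indicator (hpre.inter measurableSet_Ioi)]
  refine lintegral_congr fun y => ?_
  by_cases hy : y ∈ Ioi b
  · rw [indicator_of_mem hy, Real.abs_exp]
    by_cases hyB : Real.exp (k + y) ∈ B
    · have hyB' : y ∈ (fun y => Real.exp (k + y)) ⁻¹' B ∩ Ioi b := ⟨hyB, hy⟩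
      rw [indicator_of_mem hyB, indicator_of_mem hyB', ← jointDensity_exp hx hH₁ hv hy,
        ENNReal.ofReal_mul (Real.exp_pos _).le]
    · rw [indicator_of_notMem hyB, indicator_of_notMem fun h => hyB h.1, mul_zero]
  · rw [indicator_of_notMem hy, indicator_of_notMem fun h => hy h.2]

end BarrierGBM

theorem mainTheorem5 {Ω : Type*} [MeasurableSpace Ω] (Q : Measure Ω) [IsProbabilityMeasure Q]
    (W : ℝ≥0 → Ω → ℝ) (hW : IsBrownianReal W Q)
    (t₀ T : ℝ) (ht₀ : 0 ≤ t₀)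
    (V : ℝ → ℝ) (hV : IntegrableOn (fun l => Real.exp (2 * V l)) (Icc t₀ T))
    (M : ℝ → Ω → ℝ)
    (hM : BarrierGBM.IsWienerIntegralProcess Q W (fun l => Real.exp (V l)) t₀ T M)
    (x r H₁ β : ℝ) (hH₁ : 0 < H₁)
    (hx : BarrierGBM.barrier H₁ r β V t₀ T t₀ < x)
    (S : ℝ → Ω → ℝ) (hS : S = BarrierGBM.gbm x r V t₀ M)
    (τ : Ω → EReal)
    (hτ : τ = BarrierGBM.hitTime S (BarrierGBM.barrier H₁ r β V t₀ T) t₀ T)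
    (u : ℝ) (hu : u ∈ Ioc t₀ T) :
    AEMeasurable (S u) Q ∧
    NullMeasurableSet {ω | (u : EReal) < τ ω} Q ∧
    (∀ w : ℝ, 0 ≤ BarrierGBM.jointDensity x r H₁ β V t₀ T u w) ∧
    ∀ B : Set ℝ, MeasurableSet B →
      Q {ω | S u ω ∈ B ∧ (u : EReal) < τ ω}
        = ∫⁻ w in B, ENNReal.ofReal (BarrierGBM.jointDensity x r H₁ β V t₀ T u w) := by
  open BarrierGBM in
  subst hS hτ
  have hH := barrier_pos hH₁ r β V t₀ T t₀
  have hx0 : 0 < x := hH.trans hx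
  have huT : u ∈ Icc t₀ T := ⟨hu.1.le, hu.2⟩
  have hv : 0 < gammaSq V t₀ u := gammaSq_pos hV hu
  set b := Real.log (barrier H₁ r β V t₀ T t₀ / x) with hb
  have hb0 : b < 0 := Real.log_neg (div_pos hH hx0) ((div_lt_one hx0).2 hx)
  set X : ℝ → Ω → ℝ := fun s ω => M s ω + β * gammaSq V t₀ s with hXdef
  have hX := hM.isDriftedBrownian hW.toIsPreBrownianReal ht₀ hV β huT
  have hXu : AEMeasurable (X u) Q := hX.aemeasurable u ⟨hu.1.le, le_rfl⟩
  have hgbm : ∀ s ω, gbm x r V t₀ M s ω = Real.exp (logShift x r β V t₀ s + X s ω) :=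
    gbm_eq_exp hx0 r β V t₀ M
  have hτ : {ω | (u : EReal) < hitTime (gbm x r V t₀ M) (barrier H₁ r β V t₀ T) t₀ T ω}
      =ᵐ[Q] (hitEvent X t₀ u b)ᶜ := by
    filter_upwards [hM.continuousOn] with ω hω
    refine propext (lt_hitTime_iff (y := fun s => X s ω) (fun s => ?_)
      (hω.add ((continuousOn_gammaSq (hu.1.le.trans hu.2) hV).const_mul β)) hu.2)
    rw [hgbm, barrier_eq_exp hx0 hH₁, Real.exp_le_exp, add_le_add_iff_left]
  have hS : gbm x r V t₀ M u = fun ω => Real.exp (logShift x r β V t₀ u + X u ω) :=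
    funext (hgbm u)
  refine ⟨?_, ?_, jointDensity_nonneg hx0 hH₁ hx hv, fun B hB => ?_⟩
  · rw [hS]
    fun_prop
  · exact (hX.nullMeasurableSet_hitEvent hu.1 hb0).compl.congr hτ.symm
  · have hvt : (gammaSq V t₀ u - gammaSq V t₀ t₀).toNNReal = (gammaSq V t₀ u).toNNReal := by
      rw [gammaSq_self, sub_zero]
    have hpre : MeasurableSet ((fun y => Real.exp (logShift x r β V t₀ u + y)) ⁻¹' B) :=
      (by fun_prop : Measurable fun y => Real.exp (logShift x r β V t₀ u + y)) hB
    have hvne : (gammaSq V t₀ u - gammaSq V t₀ t₀).toNNReal ≠ 0 := by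
      rw [hvt]
      exact (Real.toNNReal_pos.2 hv).ne'
    have hmain := hX.measure_survival hu.1 hvne hb0 hpre
    rw [hvt] at hmain
    rw [setLIntegral_jointDensity hx0 hH₁ hv hB, ← hmain]
    refine measure_congr ?_
    have hSB : {ω | gbm x r V t₀ M u ω ∈ B}
        = X u ⁻¹' ((fun y => Real.exp (logShift x r β V t₀ u + y)) ⁻¹' B) := by
      rw [hS]
      rfl
    rw [← hSB]
    exact (EventuallyEq.refl _ _).inter hτ
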